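/- All graphs are finite, simple and undirected. A graph $H$ is an induced minor of a graph $G$ if $H$ can be obtained (up to isomorphism) from $G$ by a sequence of vertex deletions and edge contractions. A path or cycle is chordless if no two of its non-consecutive vertices are adjacent; a hole is a chordless cycle of length at least $4$. A long prism is a graph made of three vertex-disjoint chordless paths $P_i=a_i\dots b_i$ ($i=1,2,3$) of length at least $1$, at least one of which has length at least $2$, such that $\{a_1,a_2,a_3\}$ and $\{b_1,b_2,b_3\}$ are triangles and no edges exist between the paths except those of the two triangles. A pyramid is a graph made of three chordless paths $P_i=a\dots b_i$ ($i=1,2,3$) of length at least $1$, two of which have length at least $2$, vertex-disjoint except at $a$, such that $\{b_1,b_2,b_3\}$ is a triangle and no edges exist between the paths except those of the triangle and the three edges incident to $a$. A theta is a graph made of three internally vertex-disjoint chordless paths $P_i=a\dots b$ ($i=1,2,3$) of length at least $2$ such that no edges exist between the paths except the three edges incident to $a$ and the three edges incident to $b$. A wheel $(C,x)$ is a graph formed by a hole $C$ together with a vertex $x\notin C$ that has at least three neighbors in $C$. A sector of $(C,x)$ is a path of length at least $1$ contained in $C$ whose endpoints are neighbors of $x$ and whose internal vertices are not. A wheel is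 broken if at least two of its sectors have length at least $2$. Theorem. A graph contains $K_{2,3}$ as an induced minor if and only if it contains a long prism, a pyramid, a theta, or a broken wheel as an induced subgraph. -/

import Mathlib

namespace SimpleGraph

universe u v

/-- The graph obtained from `G` by contracting the edge `xy` (used when `x` and `y` are adjacent):
the vertex `y` is removed and `x` now stands for the merged vertex, so `x` becomes adjacent to all
vertices other than `x`, `y` that were adjacent to `x` or to `y`.  The result is simple. -/
def contractEdge {V : Type u} (G : SimpleGraph V) (x y : V) : SimpleGraph {w : V // w ≠ y} where
  Adj s t := s ≠ t ∧
    (G.Adj s t ∨ (s.1 = x ∧ G.Adj y t) ∨ (t.1 = x ∧ G.Adj y s))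
  symm := ⟨fun s t h => ⟨h.1.symm, by
    rcases h.2 with h | h | h
    · exact Or.inl h.symm
    · exact Or.inr (Or.inr h)
    · exact Or.inr (Or.inl h)⟩⟩
  loopless := ⟨fun _ h => h.1 rfl⟩

/-- `IsInducedMinor H G`: up to isomorphism, the graph `H` can be obtained from the graph `G` by a
(possibly empty, finite) sequence of vertex deletions and edge contractions. -/
inductive IsInducedMinor {U : Type v} (H : SimpleGraph U) :
    {V : Type u} → SimpleGraph V → Prop
  | iso {V : Type u} {G : SimpleGraph V} (e : H ≃g G) : IsInducedMinor H G
  | delete {V : Type u} {G : SimpleGraph V} (y : V)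
      (h : IsInducedMinor H (G.induce {w : V | w ≠ y})) : IsInducedMinor H G
  | contract {V : Type u} {G : SimpleGraph V} (x y : V) (hxy : G.Adj x y)
      (h : IsInducedMinor H (G.contractEdge x y)) : IsInducedMinor H G

/-- A walk has no chord: every edge of `G` between two of its vertices is an edge of the walk. -/
def Walk.Chordless {V : Type u} {G : SimpleGraph V} {a b : V} (p : G.Walk a b) : Prop :=
  ∀ s ∈ p.support, ∀ t ∈ p.support, G.Adj s t → s(s, t) ∈ p.edges

/-- The graph `G` is a long prism: it is made of three vertex-disjoint chordless paths
`P i = a i … b i` of length at least 1, at least one of them of length at least 2, such that the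
`a i` form a triangle, the `b i` form a triangle, and there are no other edges between the paths. -/
def IsLongPrism {V : Type u} (G : SimpleGraph V) : Prop :=
  ∃ (a b : Fin 3 → V) (P : ∀ i, G.Walk (a i) (b i)),
    (∀ i, (P i).IsPath ∧ (P i).Chordless ∧ 1 ≤ (P i).length) ∧
    (∃ i, 2 ≤ (P i).length) ∧
    (∀ i j, i ≠ j → ∀ w, w ∈ (P i).support → w ∉ (P j).support) ∧
    (∀ i j, i ≠ j → G.Adj (a i) (a j)) ∧
    (∀ i j, i ≠ j → G.Adj (b i) (b j)) ∧
    (∀ i j, i ≠ j → ∀ s ∈ (P i).support, ∀ t ∈ (P j).support, G.Adj s t →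
      (s = a i ∧ t = a j) ∨ (s = b i ∧ t = b j)) ∧
    (∀ w, ∃ i, w ∈ (P i).support)

/-- The graph `G` is a pyramid: it is made of three chordless paths `P i = a … b i` of length at
least 1, two of them of length at least 2, vertex-disjoint except at `a`, such that the `b i` form a
triangle and there are no edges between the paths except those of the triangle and those incident
to `a` (which, the paths being chordless, are the first edges of the three paths). -/
def IsPyramid {V : Type u} (G : SimpleGraph V) : Prop :=
  ∃ (a : V) (b : Fin 3 → V) (P : ∀ i, G.Walk a (b i)),
    (∀ i, (P i).IsPath ∧ (P i).Chordless ∧ 1 ≤ (P i).length) ∧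
    (∃ i j, i ≠ j ∧ 2 ≤ (P i).length ∧ 2 ≤ (P j).length) ∧
    (∀ i j, i ≠ j → ∀ w, w ∈ (P i).support → w ∈ (P j).support → w = a) ∧
    (∀ i j, i ≠ j → G.Adj (b i) (b j)) ∧
    (∀ i j, i ≠ j → ∀ s ∈ (P i).support, ∀ t ∈ (P j).support, G.Adj s t →
      (s = b i ∧ t = b j) ∨ s = a ∨ t = a) ∧
    (∀ w, ∃ i, w ∈ (P i).support)

/-- The graph `G` is a theta: it is made of three internally vertex-disjoint chordless paths
`P i = a … b` of length at least 2, with no edges between the paths except those incident to `a`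
and those incident to `b` (which, the paths being chordless, are the first and the last edges of the
three paths). -/
def IsTheta {V : Type u} (G : SimpleGraph V) : Prop :=
  ∃ (a b : V) (P : Fin 3 → G.Walk a b),
    (∀ i, (P i).IsPath ∧ (P i).Chordless ∧ 2 ≤ (P i).length) ∧
    (∀ i j, i ≠ j → ∀ w, w ∈ (P i).support → w ∈ (P j).support → w = a ∨ w = b) ∧
    (∀ i j, i ≠ j → ∀ s ∈ (P i).support, ∀ t ∈ (P j).support, G.Adj s t →
      s = a ∨ s = b ∨ t = a ∨ t = b) ∧
    (∀ w, ∃ i, w ∈ (P i).support)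

/-- A closed walk is a hole: a chordless cycle of length at least 4. -/
def Walk.IsHole {V : Type u} {G : SimpleGraph V} {r : V} (C : G.Walk r r) : Prop :=
  C.IsCycle ∧ C.Chordless ∧ 4 ≤ C.length

/-- `IsWheel C x`: the graph `G` is a wheel with rim `C` and center `x`, that is, it is formed by
the hole `C` and a vertex `x` outside `C` having at least three neighbors in `C`. -/
def IsWheel {V : Type u} {G : SimpleGraph V} {r : V} (C : G.Walk r r) (x : V) : Prop :=
  C.IsHole ∧ x ∉ C.support ∧ (∀ w, w = x ∨ w ∈ C.support) ∧
    3 ≤ {w : V | w ∈ C.support ∧ G.Adj x w}.ncard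

/-- The path `p` is a sector of the wheel with rim `C` and center `x`: it is a path (with at least
one edge) contained in the rim, its endpoints are neighbors of `x` and its internal vertices are
not. -/
def IsSector {V : Type u} {G : SimpleGraph V} {r : V} (C : G.Walk r r) (x : V)
    {a b : V} (p : G.Walk a b) : Prop :=
  p.IsPath ∧ 1 ≤ p.length ∧ (∀ e ∈ p.edges, e ∈ C.edges) ∧ G.Adj x a ∧ G.Adj x b ∧
    ∀ w ∈ p.support, w ≠ a → w ≠ b → ¬ G.Adj x w

/-- The graph `G` is a broken wheel: a wheel at least two of whose sectors have length at least 2.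
Sectors are compared as subgraphs, so a path and its reverse count as the same sector. -/
def IsBrokenWheel {V : Type u} (G : SimpleGraph V) : Prop :=
  ∃ (r : V) (C : G.Walk r r) (x : V), IsWheel C x ∧
    ∃ (a b c d : V) (p : G.Walk a b) (q : G.Walk c d),
      IsSector C x p ∧ IsSector C x q ∧ 2 ≤ p.length ∧ 2 ≤ q.length ∧
      p.toSubgraph ≠ q.toSubgraph

end SimpleGraph

/-!
Having `K_{2,3}` as an induced minor means having a model of it
(`IsInducedMinor.exists_isModel`, `IsModel.isInducedMinor`): two anticomplete connected sets `X`, `Y`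
and three pairwise anticomplete connected sets, each with edges to both `X` and `Y`.

*From a configuration to a model.* Such sets can be read off in each of the four configurations
(`IsTheta.exists_isModel` and its analogues). For a broken wheel, internal vertices `u`, `v` of two
long sectors split the rim into two arcs; each arc contains a neighbour of the center, because a rim
path without such a neighbour does not leave a sector. The arcs play the role of `X` and `Y`, and the
center, `u` and `v` are the other three branch sets.

*From a model to a configuration.* Each of the three sets contains an induced path of which only the
first vertex sees `X` and the last one sees `Y`; moving all of it but the first vertex to `Y` leaves
three pairwise nonadjacent terminals `v i` attached to both `X` and `Y`
(`IsModel.exists_isAttached`). Make `X` and `Y` minimal. Three vertices of a connected set are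
always joined inside it by an induced subdivided claw (spider) or by a triangle with three legs
(net), as `ConnectedOn.exists_spider_or_net` shows. Apply this to `X` together with the terminals.
If a terminal is the center or a corner, then it has two neighbours in `X`, and by minimality `X` is
the interior of an induced path between the other two terminals
(`IsAttached.seesTwo_of_minimal`). The same holds for `Y`.

If some terminal sees two vertices of such a path on one side and at least one on the other, the two
paths form the rim of a broken wheel centered at that terminal (`SeesTwo.isBrokenWheel`). Otherwise
the structures found on the two sides share no center or corner, the centers of two spiders are
nonadjacent, and gluing along the terminals gives a theta (two spiders), a pyramid (a spider and a
net) or a long prism (two nets).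
-/

namespace SimpleGraph

universe u v

variable {V : Type u} {G : SimpleGraph V}

/-! ### Induced paths as vertex sets -/

/-- `InducedPath G a b S`: the set `S` is the vertex set of an induced (chordless) path of `G` from
`a` to `b`; when `a = b` the path is a single vertex.  Only the vertex set is recorded, since an
induced path is determined by it. -/
inductive InducedPath (G : SimpleGraph V) : V → V → Set V → Prop
  | single (a : V) : InducedPath G a a {a}
  | cons {a b c : V} {S : Set V} (hab : G.Adj a b) (h : InducedPath G b c S) (ha : a ∉ S)
      (hS : ∀ t ∈ S, G.Adj a t → t = b) : InducedPath G a c (insert a S)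

namespace InducedPath

variable {a b c d : V} {S T : Set V}

theorem left_mem (h : InducedPath G a b S) : a ∈ S := by
  cases h <;> simp

theorem right_mem (h : InducedPath G a b S) : b ∈ S := by
  induction h with
  | single a => simp
  | cons _ _ _ _ ih => exact Set.mem_insert_of_mem _ ih

theorem eq_singleton (h : InducedPath G a a S) : S = {a} := by
  cases h with
  | single => rfl
  | cons _ h ha _ => exact absurd h.right_mem ha

/-- Two induced paths that meet only in a common end, with no edge between them except at that
end, form an induced path. -/
theorem append (h : InducedPath G a b S) (h' : InducedPath G b c T)
    (hST : ∀ s ∈ S, ∀ t ∈ T, s = t ∨ G.Adj s t → s = b ∨ t = b) :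
    InducedPath G a c (S ∪ T) := by
  induction h with
  | single a =>
    rwa [Set.union_eq_self_of_subset_left (Set.singleton_subset_iff.2 h'.left_mem)]
  | @cons a b' b S hab h ha hS ih =>
    have hbS := h.right_mem
    rw [Set.insert_union]
    refine cons hab (ih h' fun s hs t ht => hST s (Set.mem_insert_of_mem _ hs) t ht) ?_ ?_
    · rintro (h1 | h1)
      · exact ha h1
      · rcases hST a (Set.mem_insert _ _) a h1 (Or.inl rfl) with h | h <;> exact ha (h ▸ hbS)
    · rintro t (ht | ht) hat
      · exact hS t ht hat
      · rcases hST a (Set.mem_insert _ _) t ht (Or.inr hat) with h1 | h1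
        · exact absurd (h1 ▸ hbS) ha
        · exact hS t (h1 ▸ hbS) hat

theorem pair (h : G.Adj a b) : InducedPath G a b {a, b} :=
  cons h (single b) (by simpa using h.ne) (by simp)

theorem reverse (h : InducedPath G a b S) : InducedPath G b a S := by
  induction h with
  | single a => exact single a
  | @cons a b c S hab h ha hS ih =>
    have := ih.append (pair hab.symm) (by
      rintro s hs t (rfl | rfl) hst
      · exact Or.inr rfl
      · rcases hst with rfl | hst
        · exact absurd hs ha
        · exact Or.inl (hS s hs hst.symm))
    have e : S ∪ {b, a} = insert a S := by
      ext w
      simp only [Set.mem_union, Set.mem_insert_iff, Set.mem_singleton_iff]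
      constructor
      · rintro (h1 | rfl | h1)
        exacts [Or.inr h1, Or.inr h.left_mem, Or.inl h1]
      · rintro (h1 | h1)
        exacts [Or.inr (Or.inr h1), Or.inl h1]
    rwa [e] at this

/-- An induced path can be cut at any of its vertices. -/
theorem split (h : InducedPath G a b S) {p : V} (hp : p ∈ S) :
    ∃ S₁ S₂, InducedPath G a p S₁ ∧ InducedPath G p b S₂ ∧ S = S₁ ∪ S₂ ∧
      ∀ s ∈ S₁, ∀ t ∈ S₂, s = t ∨ G.Adj s t → s = p ∨ t = p := by
  induction h with
  | single a =>
    obtain rfl : p = a := hp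
    exact ⟨{p}, {p}, single p, single p, by simp, by simp⟩
  | @cons a b c S hab h ha hS ih =>
    by_cases hpa : p = a
    · subst hpa
      exact ⟨{p}, insert p S, single p, cons hab h ha hS, by simp, by simp⟩
    · obtain ⟨S₁, S₂, h1, h2, rfl, h3⟩ := ih (hp.resolve_left hpa)
      refine ⟨insert a S₁, S₂, cons hab h1 (fun h => ha (Or.inl h))
        (fun t ht => hS t (Or.inl ht)), h2, by rw [Set.insert_union], ?_⟩
      rintro s (rfl | hs) t ht hst
      · rcases hst with rfl | hst
        · exact absurd (Or.inr ht) ha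
        · obtain rfl := hS t (Or.inr ht) hst
          exact Or.inr ((h3 t h1.left_mem t ht (Or.inl rfl)).elim id id)
      · exact h3 s hs t ht hst

/-- An induced path can be cut at its last vertex satisfying a given predicate. -/
theorem exists_last (h : InducedPath G a b S) (Q : V → Prop) (hQ : ∃ t ∈ S, Q t) :
    ∃ p S₁ S₂, InducedPath G a p S₁ ∧ InducedPath G p b S₂ ∧ S = S₁ ∪ S₂ ∧
      (∀ s ∈ S₁, ∀ t ∈ S₂, s = t ∨ G.Adj s t → s = p ∨ t = p) ∧
      Q p ∧ ∀ t ∈ S₂, Q t → t = p := by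
  induction h with
  | single a =>
    obtain ⟨t, rfl, ht⟩ := hQ
    exact ⟨t, {t}, {t}, single t, single t, by simp, by simp, ht, by simp⟩
  | @cons a b c S hab h ha hS ih =>
    by_cases hq : ∃ t ∈ S, Q t
    · obtain ⟨p, S₁, S₂, h1, h2, rfl, h3, h4, h5⟩ := ih hq
      refine ⟨p, insert a S₁, S₂, cons hab h1 (fun h => ha (Or.inl h))
        (fun t ht => hS t (Or.inl ht)), h2, by rw [Set.insert_union], ?_, h4, h5⟩
      rintro s (rfl | hs) t ht hst
      · rcases hst with rfl | hst
        · exact absurd (Or.inr ht) ha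
        · obtain rfl := hS t (Or.inr ht) hst
          exact Or.inr ((h3 t h1.left_mem t ht (Or.inl rfl)).elim id id)
      · exact h3 s hs t ht hst
    · have hqa : Q a := by
        obtain ⟨t, rfl | ht, hQt⟩ := hQ
        · exact hQt
        · exact absurd ⟨t, ht, hQt⟩ hq
      refine ⟨a, {a}, insert a S, single a, cons hab h ha hS, by simp, by simp, hqa, ?_⟩
      rintro t (rfl | ht) hQt
      · rfl
      · exact absurd ⟨t, ht, hQt⟩ hq

/-- An induced path can be cut at its first vertex satisfying a given predicate. -/
theorem exists_first (h : InducedPath G a b S) (Q : V → Prop) (hQ : ∃ t ∈ S, Q t) :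
    ∃ p S₁ S₂, InducedPath G a p S₁ ∧ InducedPath G p b S₂ ∧ S = S₁ ∪ S₂ ∧
      (∀ s ∈ S₁, ∀ t ∈ S₂, s = t ∨ G.Adj s t → s = p ∨ t = p) ∧
      Q p ∧ ∀ t ∈ S₁, Q t → t = p := by
  obtain ⟨p, S₁, S₂, h1, h2, h3, h4, h5, h6⟩ := h.reverse.exists_last Q hQ
  refine ⟨p, S₂, S₁, h2.reverse, h1.reverse, by rw [h3, Set.union_comm], ?_, h5, h6⟩
  intro s hs t ht hst
  exact (h4 t ht s hs (hst.imp Eq.symm fun h => h.symm)).symm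

/-- An induced path can be cut at its first vertex `p` and at its last vertex `q` satisfying a given
predicate. -/
theorem exists_first_last (h : InducedPath G a b S) (Q : V → Prop) (hQ : ∃ t ∈ S, Q t) :
    ∃ p q S₁ S₀ S₂, InducedPath G a p S₁ ∧ InducedPath G p q S₀ ∧ InducedPath G q b S₂ ∧
      S = S₁ ∪ S₀ ∪ S₂ ∧ Q p ∧ Q q ∧ (∀ t ∈ S₁, Q t → t = p) ∧ (∀ t ∈ S₂, Q t → t = q) ∧
      (∀ s ∈ S₁, ∀ t ∈ S₀ ∪ S₂, s = t ∨ G.Adj s t → s = p ∨ t = p) ∧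
      (∀ s ∈ S₁ ∪ S₀, ∀ t ∈ S₂, s = t ∨ G.Adj s t → s = q ∨ t = q) := by
  obtain ⟨q, T, S₂, h1, h2, rfl, h3, h4, h5⟩ := h.exists_last Q hQ
  obtain ⟨p, S₁, S₀, g1, g2, rfl, g3, g4, g5⟩ := h1.exists_first Q ⟨q, h1.right_mem, h4⟩
  refine ⟨p, q, S₁, S₀, S₂, g1, g2, h2, rfl, g4, h4, g5, h5, ?_, h3⟩
  rintro s hs t (ht | ht) hst
  · exact g3 s hs t ht hst
  · rcases h3 s (Or.inl hs) t ht hst with rfl | rfl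
    · exact Or.inl (g5 _ hs h4)
    · exact g3 s hs _ g2.right_mem hst

theorem exists_adj_left (h : InducedPath G a b S) (hab : a ≠ b) : ∃ c ∈ S, G.Adj a c := by
  cases h with
  | single => exact absurd rfl hab
  | cons hac h _ _ => exact ⟨_, Or.inr h.left_mem, hac⟩

theorem exists_adj_right (h : InducedPath G a b S) (hab : a ≠ b) : ∃ c ∈ S, G.Adj b c :=
  h.reverse.exists_adj_left hab.symm

/-- The interior of an induced path of length at least two is an induced path. -/
theorem interior (h : InducedPath G a b S) (hne : a ≠ b) (hab : ¬ G.Adj a b) :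
    ∃ p q, InducedPath G p q (S \ {a, b}) ∧ G.Adj a p ∧ G.Adj b q := by
  cases h with
  | single => exact absurd rfl hne
  | @cons _ p _ S hap h ha hS =>
    have h' := h.reverse
    cases h' with
    | single => exact absurd hap hab
    | @cons _ q _ S hbq h' hb hS' =>
      refine ⟨p, q, ?_, hap, hbq⟩
      have e : insert a (insert b S) \ {a, b} = S := by
        ext w
        simp only [Set.mem_sdiff, Set.mem_insert_iff, Set.mem_singleton_iff]
        constructor
        · tauto
        · intro hw
          refine ⟨by tauto, ?_⟩
          rintro (rfl | rfl)
          · exact ha (Or.inr hw)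
          · exact hb hw
      rw [e]
      exact h'.reverse

/-- An induced path is the support of a chordless walk. -/
theorem exists_walk (h : InducedPath G a b S) :
    ∃ p : G.Walk a b, p.IsPath ∧ p.Chordless ∧ ∀ w, w ∈ p.support ↔ w ∈ S := by
  induction h with
  | single a =>
    refine ⟨Walk.nil, Walk.IsPath.nil, ?_, by simp⟩
    intro s hs t ht hst
    simp only [Walk.support_nil, List.mem_singleton] at hs ht
    subst hs ht
    exact absurd hst (G.loopless.irrefl _)
  | @cons a b c S hab h ha hS ih =>
    obtain ⟨p, hp, hc, hsup⟩ := ih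
    refine ⟨Walk.cons hab p, ?_, ?_, ?_⟩
    · rw [Walk.cons_isPath_iff]
      exact ⟨hp, fun h => ha ((hsup a).1 h)⟩
    · intro s hs t ht hst
      simp only [Walk.support_cons, List.mem_cons, Walk.edges_cons] at hs ht ⊢
      rcases hs with rfl | hs <;> rcases ht with rfl | ht
      · exact absurd hst (G.loopless.irrefl _)
      · rw [hS t ((hsup t).1 ht) hst]
        exact Or.inl rfl
      · rw [hS s ((hsup s).1 hs) hst.symm]
        exact Or.inl Sym2.eq_swap
      · exact Or.inr (hc s hs t ht hst)
    · intro w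
      simp [hsup]

/-- The support of a chordless walk without repeated vertices is an induced path. -/
theorem of_walk {a b : V} (p : G.Walk a b) (hp : p.IsPath) (hc : p.Chordless) :
    InducedPath G a b {w | w ∈ p.support} := by
  induction p with
  | nil => simpa using single _
  | @cons a b c hab p ih =>
    rw [Walk.cons_isPath_iff] at hp
    have hb : b ∈ p.support := p.start_mem_support
    have key : ∀ t ∈ p.support, G.Adj a t → t = b := by
      intro t ht hat
      have := hc a (by simp) t (by simp [ht]) hat
      rw [Walk.edges_cons, List.mem_cons] at this
      rcases this with h | h
      · rcases Sym2.eq_iff.1 h with h | h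
        · exact h.2
        · exact absurd (h.1 ▸ hb) hp.2
      · exact absurd (p.fst_mem_support_of_mem_edges h) hp.2
    have h1 := ih hp.1 (by
      intro s hs t ht hst
      have := hc s (by simp [hs]) t (by simp [ht]) hst
      rw [Walk.edges_cons, List.mem_cons] at this
      rcases this with h | h
      · rcases Sym2.eq_iff.1 h with h | h
        · exact absurd (h.1 ▸ hs) hp.2
        · exact absurd (h.2 ▸ ht) hp.2
      · exact h)
    have h2 := cons hab h1 hp.2 key
    convert h2 using 1
    ext w
    simp

end InducedPath

/-! ### Connected vertex sets -/

/-- `G.Joined D a b`: the vertices `a` and `b` are joined by a path of `G` inside the set `D`.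
Taking the path induced loses nothing, since the graph is simple. -/
def Joined (G : SimpleGraph V) (D : Set V) (a b : V) : Prop :=
  ∃ S ⊆ D, InducedPath G a b S

/-- The set `D` induces a connected (or empty) subgraph of `G`. -/
def ConnectedOn (G : SimpleGraph V) (D : Set V) : Prop :=
  ∀ a ∈ D, ∀ b ∈ D, G.Joined D a b

section ConnectedOn

variable {D E : Set V} {a b c : V}

namespace Joined

theorem refl (ha : a ∈ D) : G.Joined D a a :=
  ⟨{a}, Set.singleton_subset_iff.2 ha, .single a⟩

theorem symm (h : G.Joined D a b) : G.Joined D b a :=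
  let ⟨S, hS, h⟩ := h
  ⟨S, hS, h.reverse⟩

theorem mono (h : G.Joined D a b) (hDE : D ⊆ E) : G.Joined E a b :=
  let ⟨S, hS, h⟩ := h
  ⟨S, hS.trans hDE, h⟩

/-- Prepending a vertex to an induced path: shortcut from it to its last neighbour on the path. -/
theorem head (hab : G.Adj a b) (ha : a ∈ D) (h : G.Joined D b c) : G.Joined D a c := by
  obtain ⟨S, hS, h⟩ := h
  by_cases haS : a ∈ S
  · obtain ⟨S₁, S₂, -, h2, rfl, -⟩ := h.split haS
    exact ⟨S₂, fun w hw => hS (Or.inr hw), h2⟩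
  · obtain ⟨p, S₁, S₂, -, h2, rfl, -, h4, h5⟩ := h.exists_last (G.Adj a) ⟨b, h.left_mem, hab⟩
    exact ⟨insert a S₂, Set.insert_subset ha fun w hw => hS (Or.inr hw),
      h2.cons h4 (fun h => haS (Or.inr h)) h5⟩

theorem trans (h : G.Joined D a b) (h' : G.Joined D b c) : G.Joined D a c := by
  obtain ⟨S, hS, h⟩ := h
  induction h with
  | single a => exact h'
  | @cons a b d S hab h ha _ ih =>
    exact head hab (hS (Set.mem_insert _ _)) (ih h' fun w hw => hS (Set.mem_insert_of_mem _ hw))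

theorem of_adj (h : G.Adj a b) (ha : a ∈ D) (hb : b ∈ D) : G.Joined D a b :=
  head h ha (refl hb)

theorem of_walk {a b : V} (p : G.Walk a b) (h : ∀ w ∈ p.support, w ∈ D) : G.Joined D a b := by
  induction p with
  | nil => exact refl (h _ (by simp))
  | cons hab p ih =>
    exact head hab (h _ (by simp)) (ih fun w hw => h w (by simp [hw]))

/-- A set of vertices closed under adjacency within `D` contains everything joined inside `D` to
one of its members. -/
theorem mem_of_closed (h : G.Joined D a b) {K : Set V} (ha : a ∈ K)
    (hK : ∀ s ∈ K, ∀ t ∈ D, G.Adj s t → t ∈ K) : b ∈ K := by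
  obtain ⟨S, hS, h⟩ := h
  induction h with
  | single a => exact ha
  | @cons a b c S hab h _ _ ih =>
    exact ih (hK a ha b (hS (Or.inr h.left_mem)) hab) fun w hw => hS (Or.inr hw)

/-- Paths are carried along by a map of vertices that sends edges to joined pairs. -/
theorem map {W : Type v} {H : SimpleGraph W} {D : Set W} {E : Set V} {a b : W} (f : W → V)
    (hf : ∀ s ∈ D, ∀ t ∈ D, H.Adj s t → G.Joined E (f s) (f t)) (hD : ∀ s ∈ D, f s ∈ E)
    (h : H.Joined D a b) : G.Joined E (f a) (f b) := by
  obtain ⟨S, hS, h⟩ := h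
  induction h with
  | single a => exact refl (hD a (hS rfl))
  | @cons a b c S hab h _ _ ih =>
    exact (hf a (hS (Or.inl rfl)) b (hS (Or.inr h.left_mem)) hab).trans
      (ih fun w hw => hS (Or.inr hw))

end Joined

namespace ConnectedOn

theorem singleton (a : V) : G.ConnectedOn {a} := by
  rintro _ rfl _ rfl
  exact Joined.refl rfl

theorem of_root (r : V) (h : ∀ w ∈ D, G.Joined D w r) : G.ConnectedOn D :=
  fun a ha b hb => (h a ha).trans (h b hb).symm

theorem union (hD : G.ConnectedOn D) (hE : G.ConnectedOn E) (ha : a ∈ D) (hb : b ∈ E)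
    (hab : G.Adj a b) : G.ConnectedOn (D ∪ E) := by
  refine of_root a ?_
  rintro w (hw | hw)
  · exact (hD w hw a ha).mono Set.subset_union_left
  · exact ((hE w hw b hb).mono Set.subset_union_right).trans
      (Joined.of_adj hab.symm (Or.inr hb) (Or.inl ha))

theorem insert_of_adj (hD : G.ConnectedOn D) (hb : b ∈ D) (hab : G.Adj a b) :
    G.ConnectedOn (insert a D) :=
  (singleton a).union hD rfl hb hab

/-- A connected set properly containing a nonempty set `D` is left by an edge from `D`. -/
theorem exists_adj (hE : G.ConnectedOn E) (ha : a ∈ D) (hDE : D ⊆ E) (hb : b ∈ E) (hbD : b ∉ D) :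
    ∃ s ∈ D, ∃ t ∈ E, t ∉ D ∧ G.Adj s t := by
  by_contra! hcon
  exact hbD ((hE a (hDE ha) b hb).mem_of_closed ha fun s hs t ht hst => by
    by_contra htD
    exact hcon s hs t ht htD hst)

/-- Outside a connected proper subset `D` of a connected set `X` there is a vertex whose removal
leaves `X` connected: grow `D` by one vertex at a time. -/
theorem exists_diff_singleton [Finite V] {X : Set V} (hX : G.ConnectedOn X)
    (hD : G.ConnectedOn D) (ha : a ∈ D) (hDX : D ⊂ X) :
    ∃ u ∈ X, u ∉ D ∧ G.ConnectedOn (X \ {u}) := by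
  obtain ⟨M, ⟨hM1, hM2, hM3⟩, hmax⟩ := Set.Finite.exists_maximalFor (fun M : Set V => M)
    {M | D ⊆ M ∧ M ⊂ X ∧ G.ConnectedOn M} (Set.toFinite _) ⟨D, subset_rfl, hDX, hD⟩
  obtain ⟨b, hbX, hbM⟩ := Set.exists_of_ssubset hM2
  obtain ⟨s, hs, t, htX, htM, hst⟩ := hX.exists_adj (hM1 ha) hM2.1 hbX hbM
  have hins : insert t M = X := by
    by_contra hne
    exact htM (hmax ⟨hM1.trans (Set.subset_insert _ _),
      (Set.insert_subset htX hM2.1).ssubset_of_ne hne, hM3.insert_of_adj hs hst.symm⟩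
      (Set.subset_insert t M) (Set.mem_insert t M))
  refine ⟨t, htX, fun h => htM (hM1 h), ?_⟩
  rwa [← hins, Set.insert_sdiff_of_mem _ (Set.mem_singleton t), Set.sdiff_singleton_eq_self htM]

end ConnectedOn

theorem InducedPath.connectedOn {S : Set V} (h : InducedPath G a b S) : G.ConnectedOn S := by
  refine ConnectedOn.of_root b fun w hw => ?_
  obtain ⟨S₁, S₂, -, h2, rfl, -⟩ := h.split hw
  exact ⟨S₂, Set.subset_union_right, h2⟩

end ConnectedOn

/-! ### Induced minors and models -/

section Model

variable {U : Type v} {H : SimpleGraph U}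

/-- A model of `H` in `G`: disjoint nonempty connected vertex sets `B u`, one for each vertex `u` of
`H`, with an edge of `G` between `B u` and `B u'` exactly when `u` and `u'` are adjacent in `H`. -/
def IsModel (H : SimpleGraph U) (G : SimpleGraph V) (B : U → Set V) : Prop :=
  (∀ u, (B u).Nonempty) ∧ (∀ u, G.ConnectedOn (B u)) ∧
    (∀ u u' w, w ∈ B u → w ∈ B u' → u = u') ∧
    ∀ u u', u ≠ u' → (H.Adj u u' ↔ ∃ w ∈ B u, ∃ w' ∈ B u', G.Adj w w')

theorem IsModel.of_induce {S : Set V} {B : U → Set S} (h : IsModel H (G.induce S) B) :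
    IsModel H G fun u => Subtype.val '' B u := by
  obtain ⟨h1, h2, h3, h4⟩ := h
  refine ⟨fun u => (h1 u).image _, ?_, ?_, ?_⟩
  · rintro u _ ⟨a, ha, rfl⟩ _ ⟨b, hb, rfl⟩
    exact (h2 u a ha b hb).map (E := Subtype.val '' B u) Subtype.val
      (fun s hs t ht hst => Joined.of_adj hst ⟨s, hs, rfl⟩ ⟨t, ht, rfl⟩) fun s hs => ⟨s, hs, rfl⟩
  · rintro u u' _ ⟨a, ha, rfl⟩ ⟨b, hb, hab⟩
    obtain rfl := Subtype.ext hab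
    exact h3 u u' b ha hb
  · intro u u' hne
    rw [h4 u u' hne]
    constructor
    · rintro ⟨a, ha, b, hb, hab⟩
      exact ⟨a, ⟨a, ha, rfl⟩, b, ⟨b, hb, rfl⟩, hab⟩
    · rintro ⟨_, ⟨a, ha, rfl⟩, _, ⟨b, hb, rfl⟩, hab⟩
      exact ⟨a, ha, b, hb, hab⟩

/-- The projection of `G` onto the contraction of the edge `xy` sends `y` to `x` and fixes all other
vertices; it maps edges to edges or collapses them. -/
theorem exists_contractEdge_proj (G : SimpleGraph V) {x y : V} (hxy : x ≠ y) :
    ∃ f : V → {w : V // w ≠ y}, f y = ⟨x, hxy⟩ ∧ (∀ w : {w : V // w ≠ y}, f w = w) ∧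
      ∀ s t, G.Adj s t → f s ≠ f t → (G.contractEdge x y).Adj (f s) (f t) := by
  classical
  let f : V → {w : V // w ≠ y} := fun w => if h : w = y then ⟨x, hxy⟩ else ⟨w, h⟩
  have hfy : f y = ⟨x, hxy⟩ := by simp [f]
  have hf : ∀ w : {w : V // w ≠ y}, f w = w := fun w => by simp [f, w.2]
  refine ⟨f, hfy, hf, ?_⟩
  intro s t hst hne
  refine ⟨hne, ?_⟩
  by_cases hs : s = y
  · subst hs
    have ht : t ≠ s := hst.ne'
    exact Or.inr (Or.inl ⟨by rw [hfy], by rw [hf ⟨t, ht⟩]; exact hst⟩)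
  · by_cases ht : t = y
    · subst ht
      exact Or.inr (Or.inr ⟨by rw [hfy], by rw [hf ⟨s, hs⟩]; exact hst.symm⟩)
    · exact Or.inl (by rw [hf ⟨s, hs⟩, hf ⟨t, ht⟩]; exact hst)

theorem IsModel.of_contractEdge {x y : V} (hxy : G.Adj x y) {B : U → Set {w : V // w ≠ y}}
    (h : IsModel H (G.contractEdge x y) B) :
    ∃ B' : U → Set V, IsModel H G B' := by
  obtain ⟨h1, h2, h3, h4⟩ := h
  have hxy' : x ≠ y := hxy.ne
  -- The vertex `y` joins the branch set of `x`.
  obtain ⟨f, hfy, hf, hproj⟩ := G.exists_contractEdge_proj hxy'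
  have hlift : ∀ s : {w : V // w ≠ y}, ∀ t : {w : V // w ≠ y},
      (G.contractEdge x y).Adj s t → ∃ s' t', f s' = s ∧ f t' = t ∧ G.Adj s' t' := by
    rintro s t ⟨-, hst | ⟨hs, hst⟩ | ⟨ht, hst⟩⟩
    · exact ⟨s, t, hf s, hf t, hst⟩
    · exact ⟨y, t, by rw [hfy]; exact Subtype.ext hs.symm, hf t, hst⟩
    · exact ⟨s, y, hf s, by rw [hfy]; exact Subtype.ext ht.symm, hst.symm⟩
  have hroot : ∀ u a, f a ∈ B u → G.Joined (f ⁻¹' B u) a (f a) := by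
    intro u a ha
    by_cases hay : a = y
    · subst hay
      rw [hfy]
      refine Joined.of_adj hxy.symm ha ?_
      change f x ∈ B u
      rw [hf ⟨x, hxy'⟩, ← hfy]
      exact ha
    · rw [hf ⟨a, hay⟩]
      exact Joined.refl ha
  refine ⟨fun u => f ⁻¹' B u, ?_, ?_, ?_, ?_⟩
  · intro u
    obtain ⟨w, hw⟩ := h1 u
    exact ⟨w, by simpa [hf w] using hw⟩
  · intro u a ha b hb
    refine (hroot u a ha).trans (Joined.trans ?_ (hroot u b hb).symm)
    refine (h2 u _ ha _ hb).map Subtype.val ?_ ?_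
    · intro s hs t ht hst
      obtain ⟨s', t', hs', ht', hst'⟩ := hlift s t hst
      have e1 : f s' ∈ B u := hs' ▸ hs
      have e2 : f t' ∈ B u := ht' ▸ ht
      have := (hroot u s' e1).symm.trans
        ((Joined.of_adj hst' e1 e2).trans (hroot u t' e2))
      rwa [hs', ht'] at this
    · intro s hs
      change f s ∈ B u
      rwa [hf s]
  · intro u u' w hw hw'
    exact h3 u u' _ hw hw'
  · intro u u' hne
    rw [h4 u u' hne]
    constructor
    · rintro ⟨s, hs, t, ht, hst⟩
      obtain ⟨s', t', rfl, rfl, hst'⟩ := hlift s t hst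
      exact ⟨s', hs, t', ht, hst'⟩
    · rintro ⟨s, hs, t, ht, hst⟩
      refine ⟨f s, hs, f t, ht, hproj s t hst fun h => hne (h3 u u' (f s) hs ?_)⟩
      rw [h]
      exact ht

theorem IsInducedMinor.exists_isModel (h : IsInducedMinor H G) : ∃ B, IsModel H G B := by
  induction h with
  | @iso V G e =>
    refine ⟨fun u => {e u}, fun u => Set.singleton_nonempty _, fun u => .singleton _, ?_, ?_⟩
    · rintro u u' w rfl hw
      exact e.injective hw
    · intro u u' _
      simp [e.map_adj_iff]
  | delete y _ ih =>
    obtain ⟨B, hB⟩ := ih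
    exact ⟨_, hB.of_induce⟩
  | contract x y hxy _ ih =>
    obtain ⟨B, hB⟩ := ih
    exact hB.of_contractEdge hxy

theorem IsModel.induce {S : Set V} {B : U → Set V} (h : IsModel H G B) (hS : ∀ u, B u ⊆ S) :
    IsModel H (G.induce S) fun u => Subtype.val ⁻¹' B u := by
  obtain ⟨h1, h2, h3, h4⟩ := h
  have hjoin : ∀ (D : Set V), D ⊆ S → ∀ a b : S, G.Joined D a b →
      (G.induce S).Joined (Subtype.val ⁻¹' D) a b := by
    rintro D hD ⟨a, ha⟩ ⟨b, hb⟩ hab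
    change G.Joined D a b at hab
    obtain ⟨T, hT, hab⟩ := hab
    induction hab with
    | single a => exact Joined.refl (hT rfl)
    | @cons a c b T hac hcb _ _ ih =>
      have hc : c ∈ D := hT (Or.inr hcb.left_mem)
      have hadj : (G.induce S).Adj ⟨a, ha⟩ ⟨c, hD hc⟩ := hac
      exact Joined.head hadj (hT (Or.inl rfl))
        (ih _ _ (fun w hw => hT (Or.inr hw)))
  refine ⟨?_, ?_, ?_, ?_⟩
  · intro u
    obtain ⟨w, hw⟩ := h1 u
    exact ⟨⟨w, hS u hw⟩, hw⟩
  · intro u a ha b hb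
    exact hjoin _ (hS u) a b (h2 u a ha b hb)
  · intro u u' w hw hw'
    exact h3 u u' w hw hw'
  · intro u u' hne
    rw [h4 u u' hne]
    constructor
    · rintro ⟨a, ha, b, hb, hab⟩
      exact ⟨⟨a, hS u ha⟩, ha, ⟨b, hS u' hb⟩, hb, hab⟩
    · rintro ⟨a, ha, b, hb, hab⟩
      exact ⟨a, ha, b, hb, hab⟩

theorem IsModel.contractEdge {x y : V} (hxy : G.Adj x y) {B : U → Set V} (h : IsModel H G B)
    {u₀ : U} (hx : x ∈ B u₀) (hy : y ∈ B u₀) :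
    IsModel H (G.contractEdge x y) fun u => Subtype.val ⁻¹' B u := by
  obtain ⟨h1, h2, h3, h4⟩ := h
  have hxy' : x ≠ y := hxy.ne
  obtain ⟨f, hfy, hf, hproj⟩ := G.exists_contractEdge_proj hxy'
  have hfB : ∀ u a, a ∈ B u → (f a : V) ∈ B u := by
    intro u a ha
    by_cases hay : a = y
    · subst hay
      rw [hfy, h3 u u₀ a ha hy]
      exact hx
    · rw [hf ⟨a, hay⟩]
      exact ha
  refine ⟨?_, ?_, ?_, ?_⟩
  · intro u
    obtain ⟨w, hw⟩ := h1 u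
    exact ⟨f w, hfB u w hw⟩
  · intro u a ha b hb
    have := (h2 u a ha b hb).map (H := G) (G := G.contractEdge x y)
      (E := Subtype.val ⁻¹' B u) f ?_ (fun s hs => hfB u s hs)
    · rwa [hf a, hf b] at this
    · intro s hs t ht hst
      by_cases hne : f s = f t
      · rw [hne]
        exact Joined.refl (hfB u t ht)
      · exact Joined.of_adj (hproj s t hst hne) (hfB u s hs) (hfB u t ht)
  · intro u u' w hw hw'
    exact h3 u u' w hw hw'
  · intro u u' hne
    rw [h4 u u' hne]
    constructor
    · rintro ⟨a, ha, b, hb, hab⟩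
      refine ⟨f a, hfB u a ha, f b, hfB u' b hb, hproj a b hab fun h => ?_⟩
      exact hne (h3 u u' _ (hfB u a ha) (h ▸ hfB u' b hb))
    · rintro ⟨a, ha, b, hb, -, hab | ⟨hax, hab⟩ | ⟨hbx, hab⟩⟩
      · exact ⟨a, ha, b, hb, hab⟩
      · obtain rfl : u = u₀ := h3 u u₀ a ha (hax ▸ hx)
        exact ⟨y, hy, b, hb, hab⟩
      · obtain rfl : u' = u₀ := h3 u' u₀ b hb (hbx ▸ hx)
        exact ⟨a, ha, y, hy, hab.symm⟩

/-- Delete the vertices outside the branch sets and contract the edges inside them. -/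
theorem IsModel.isInducedMinor [Finite V] {B : U → Set V} (h : IsModel H G B) :
    IsInducedMinor H G := by
  induction hn : Nat.card V using Nat.strong_induction_on generalizing V with
  | _ n ih =>
    have hcard : ∀ y : V, Nat.card {w : V // w ≠ y} < n := by
      intro y
      rw [← hn]
      exact Finite.card_subtype_lt (x := y) (by simp)
    by_cases hcov : ∃ y, ∀ u, y ∉ B u
    · obtain ⟨y, hy⟩ := hcov
      refine .delete y (ih _ (hcard y) (h.induce fun u w hw => ?_) rfl)
      rintro rfl
      exact hy u hw
    push Not at hcov
    by_cases hbig : ∃ u, ∃ a ∈ B u, ∃ b ∈ B u, a ≠ b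
    · obtain ⟨u, a, ha, b, hb, hab⟩ := hbig
      obtain ⟨S, hS, hP⟩ := h.2.1 u a ha b hb
      obtain ⟨c, hc, hac⟩ := hP.exists_adj_left hab
      exact .contract a c hac (ih _ (hcard c) (h.contractEdge hac ha (hS hc)) rfl)
    push Not at hbig
    obtain ⟨h1, -, h3, h4⟩ := h
    choose g hg using h1
    refine .iso ⟨Equiv.ofBijective g ⟨?_, ?_⟩, ?_⟩
    · intro u u' huu
      exact h3 u u' (g u) (hg u) (huu ▸ hg u')
    · intro y
      obtain ⟨u, hu⟩ := hcov y
      exact ⟨u, hbig u _ (hg u) _ hu⟩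
    · intro u u'
      change G.Adj (g u) (g u') ↔ H.Adj u u'
      by_cases hne : u = u'
      · subst hne
        simp
      · rw [h4 u u' hne]
        constructor
        · intro hadj
          exact ⟨_, hg u, _, hg u', hadj⟩
        · rintro ⟨a, ha, b, hb, hab⟩
          rwa [hbig u _ (hg u) _ ha, hbig u' _ (hg u') _ hb]

end Model

/-! ### Models of `K_{2,3}` in the four configurations -/

/-- The sets `S` and `T` are disjoint and no edge of `G` joins them. -/
def Anticomplete (G : SimpleGraph V) (S T : Set V) : Prop :=
  ∀ s ∈ S, ∀ t ∈ T, s ≠ t ∧ ¬ G.Adj s t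

theorem Anticomplete.symm {S T : Set V} (h : G.Anticomplete S T) : G.Anticomplete T S :=
  fun s hs t ht => ⟨(h t ht s hs).1.symm, fun hst => (h t ht s hs).2 hst.symm⟩

/-- Some edge of `G` joins the sets `S` and `T`. -/
def Touches (G : SimpleGraph V) (S T : Set V) : Prop :=
  ∃ s ∈ S, ∃ t ∈ T, G.Adj s t

theorem Touches.symm {S T : Set V} (h : G.Touches S T) : G.Touches T S :=
  let ⟨s, hs, t, ht, hst⟩ := h
  ⟨t, ht, s, hs, hst.symm⟩

/-- The branch sets `X`, `Y` of one side and `A 0`, `A 1`, `A 2` of the other form a model of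
`K_{2,3}`. -/
theorem isModel_completeBipartiteGraph {X Y : Set V} {A : Fin 3 → Set V}
    (hX : G.ConnectedOn X) (hY : G.ConnectedOn Y) (hA : ∀ i, G.ConnectedOn (A i))
    (hXY : G.Anticomplete X Y) (hAA : ∀ i j, i ≠ j → G.Anticomplete (A i) (A j))
    (hXA : ∀ i, G.Touches X (A i)) (hYA : ∀ i, G.Touches Y (A i))
    (dXA : ∀ i, Disjoint X (A i)) (dYA : ∀ i, Disjoint Y (A i)) :
    IsModel (completeBipartiteGraph (Fin 2) (Fin 3)) G (Sum.elim ![X, Y] A) := by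
  refine ⟨?_, ?_, ?_, ?_⟩
  · rintro (i | i)
    · obtain ⟨s, hs, -⟩ := hXA 0
      obtain ⟨t, ht, -⟩ := hYA 0
      fin_cases i
      exacts [⟨s, hs⟩, ⟨t, ht⟩]
    · obtain ⟨s, -, t, ht, -⟩ := hXA i
      exact ⟨t, ht⟩
  · rintro (i | i)
    · fin_cases i
      exacts [hX, hY]
    · exact hA i
  · rintro (i | i) (j | j) w hi hj
    · fin_cases i <;> fin_cases j
      exacts [rfl, absurd rfl (hXY w hi w hj).1, absurd rfl (hXY w hj w hi).1, rfl]
    · fin_cases i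
      exacts [((dXA j).notMem_of_mem_left hi hj).elim, ((dYA j).notMem_of_mem_left hi hj).elim]
    · fin_cases j
      exacts [((dXA i).notMem_of_mem_left hj hi).elim, ((dYA i).notMem_of_mem_left hj hi).elim]
    · by_contra hne
      exact (hAA i j (fun h => hne (by rw [h])) w hi w hj).1 rfl
  · rintro (i | i) (j | j) hne
    · simp only [completeBipartiteGraph_adj, Sum.isLeft_inl, Sum.isRight_inl, Bool.false_eq_true,
        and_false, false_and, or_self, false_iff]
      rintro ⟨s, hs, t, ht, hst⟩
      fin_cases i <;> fin_cases j
      exacts [hne rfl, (hXY s hs t ht).2 hst, (hXY t ht s hs).2 hst.symm, hne rfl]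
    · simp only [completeBipartiteGraph_adj, Sum.isLeft_inl, Sum.isRight_inr, and_self, true_or,
        true_iff]
      fin_cases i
      exacts [hXA j, hYA j]
    · simp only [completeBipartiteGraph_adj, Sum.isLeft_inl, Sum.isRight_inr, and_self, or_true,
        true_iff]
      fin_cases j
      exacts [(hXA i).symm, (hYA i).symm]
    · simp only [completeBipartiteGraph_adj, Sum.isLeft_inr, Sum.isRight_inr, Bool.false_eq_true,
        and_false, false_and, or_self, false_iff]
      rintro ⟨s, hs, t, ht, hst⟩
      exact (hAA i j (fun h => hne (by rw [h])) s hs t ht).2 hst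

theorem InducedPath.tail {a b : V} {S : Set V} (h : InducedPath G a b S) (hab : a ≠ b) :
    ∃ c, G.Adj a c ∧ InducedPath G c b (S \ {a}) ∧ ∀ t ∈ S, G.Adj a t → t = c := by
  cases h with
  | single => exact absurd rfl hab
  | @cons _ c _ S hac h ha hS =>
    refine ⟨c, hac, ?_, ?_⟩
    · rwa [Set.insert_sdiff_of_mem _ (Set.mem_singleton a), Set.sdiff_singleton_eq_self ha]
    · rintro t (rfl | ht) hat
      · exact absurd hat (G.loopless.irrefl _)
      · exact hS t ht hat

theorem Walk.IsPath.ne_of_one_le_length {a b : V} {p : G.Walk a b} (hp : p.IsPath)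
    (hl : 1 ≤ p.length) : a ≠ b := by
  cases p with
  | nil => simp at hl
  | cons h p =>
    rw [Walk.cons_isPath_iff] at hp
    rintro rfl
    exact hp.2 p.end_mem_support

theorem Walk.Chordless.not_adj {a b : V} {p : G.Walk a b} (hc : p.Chordless) (hp : p.IsPath)
    (hl : 2 ≤ p.length) : ¬ G.Adj a b := by
  intro hab
  have := hp.length_eq_one_of_mem_edges (hc a p.start_mem_support b p.end_mem_support hab)
  lia

theorem exists_fin3_ne (i j : Fin 3) : ∃ k, k ≠ i ∧ k ≠ j := by
  decide +revert

theorem fin3_cases {i j k : Fin 3} (hij : i ≠ j) (hik : k ≠ i) (hjk : k ≠ j) (m : Fin 3) :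
    m = i ∨ m = j ∨ m = k := by
  decide +revert

/-- A relation between distinct indices may be checked on three pairs when it is symmetric. -/
theorem fin3_pairs {R : Fin 3 → Fin 3 → Prop} (hR : ∀ i j, R i j → R j i) (h01 : R 0 1)
    (h02 : R 0 2) (h12 : R 1 2) (i j : Fin 3) (hij : i ≠ j) : R i j := by
  fin_cases i <;> fin_cases j
  exacts [absurd rfl hij, h01, h02, hR _ _ h01, absurd rfl hij, h12, hR _ _ h02, hR _ _ h12,
    absurd rfl hij]

/-- In a theta, one end `a`, its three neighbours, and the rest form a model. -/
theorem IsTheta.exists_isModel (h : G.IsTheta) :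
    ∃ B, IsModel (completeBipartiteGraph (Fin 2) (Fin 3)) G B := by
  obtain ⟨a, b, P, hP, hdisj, hedge, -⟩ := h
  have hab : a ≠ b := (hP 0).1.ne_of_one_le_length (by have := (hP 0).2.2; lia)
  have hnab : ¬ G.Adj a b := (hP 0).2.1.not_adj (hP 0).1 (hP 0).2.2
  set S : Fin 3 → Set V := fun i => {w | w ∈ (P i).support} with hS
  have hpath : ∀ i, InducedPath G a b (S i) := fun i => .of_walk _ (hP i).1 (hP i).2.1
  choose c hac hT hc using fun i => (hpath i).tail hab
  have hcb : ∀ i, c i ≠ b := fun i h => hnab (h ▸ hac i)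
  choose d hcd hR _ using fun i => (hT i).tail (hcb i)
  have hcS : ∀ i, c i ∈ S i := fun i => (hT i).left_mem.1
  have hca : ∀ i, c i ≠ a := fun i => (hac i).ne'
  have hcc : ∀ i j, c i ∈ S j → i = j := by
    intro i j hj
    by_contra hne
    rcases hdisj i j hne (c i) (hcS i) hj with h | h
    exacts [hca i h, hcb i h]
  refine ⟨_, isModel_completeBipartiteGraph (X := {a}) (Y := ⋃ i, (S i \ {a}) \ {c i})
    (A := fun i => {c i}) (.singleton _) ?_ (fun i => .singleton _) ?_ ?_ ?_ ?_ ?_ ?_⟩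
  · refine .of_root b fun w hw => ?_
    obtain ⟨i, hi⟩ := Set.mem_iUnion.1 hw
    exact ((hR i).connectedOn w hi b (hR i).right_mem).mono (Set.subset_iUnion_of_subset i subset_rfl)
  · rintro _ rfl t ht
    obtain ⟨i, ⟨hti, hta⟩, htc⟩ := Set.mem_iUnion.1 ht
    exact ⟨fun h => hta h.symm, fun h => htc (hc i t hti h)⟩
  · rintro i j hij _ rfl _ rfl
    refine ⟨fun h => hij (hcc i j (h ▸ hcS j)), fun h => ?_⟩
    rcases hedge i j hij _ (hcS i) _ (hcS j) h with h | h | h | h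
    exacts [hca i h, hcb i h, hca j h, hcb j h]
  · exact fun i => ⟨a, rfl, c i, rfl, hac i⟩
  · exact fun i => ⟨d i, Set.mem_iUnion.2 ⟨i, (hR i).left_mem⟩, c i, rfl, (hcd i).symm⟩
  · exact fun i => Set.disjoint_singleton.2 (hca i).symm
  · refine fun i => Set.disjoint_singleton_right.2 fun h => ?_
    obtain ⟨j, ⟨hj, -⟩, hj'⟩ := Set.mem_iUnion.1 h
    obtain rfl := hcc i j hj
    exact hj' rfl

/-- In a pyramid with apex `a`, a model is given by `a`, its neighbours on two long paths, the
third path without `a`, and the rest. -/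
theorem IsPyramid.exists_isModel (h : G.IsPyramid) :
    ∃ B, IsModel (completeBipartiteGraph (Fin 2) (Fin 3)) G B := by
  obtain ⟨a, b, P, hP, ⟨i, j, hij, hli, hlj⟩, hdisj, hbb, hedge, -⟩ := h
  obtain ⟨k, hki, hkj⟩ := exists_fin3_ne i j
  have hab : ∀ m, a ≠ b m := fun m => (hP m).1.ne_of_one_le_length (hP m).2.2
  have hnabi : ¬ G.Adj a (b i) := (hP i).2.1.not_adj (hP i).1 hli
  have hnabj : ¬ G.Adj a (b j) := (hP j).2.1.not_adj (hP j).1 hlj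
  set S : Fin 3 → Set V := fun i => {w | w ∈ (P i).support} with hS
  have hpath : ∀ i, InducedPath G a (b i) (S i) := fun i => .of_walk _ (hP i).1 (hP i).2.1
  choose c hac hT hc using fun i => (hpath i).tail (hab i)
  have hcbi : c i ≠ b i := fun h => hnabi (h ▸ hac i)
  have hcbj : c j ≠ b j := fun h => hnabj (h ▸ hac j)
  obtain ⟨di, hcdi, hRi, -⟩ := (hT i).tail hcbi
  obtain ⟨dj, hcdj, hRj, -⟩ := (hT j).tail hcbj
  have hcS : ∀ i, c i ∈ S i := fun i => (hT i).left_mem.1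
  have hca : ∀ i, c i ≠ a := fun i => (hac i).ne'
  have hsep : ∀ m n, m ≠ n → ∀ s ∈ S m, ∀ t ∈ S n, s ≠ a → t ≠ a →
      s ≠ t ∧ (G.Adj s t → s = b m ∧ t = b n) := by
    intro m n hmn s hs t ht hsa hta
    refine ⟨?_, fun h => ?_⟩
    · rintro rfl
      exact hsa (hdisj m n hmn s hs ht)
    · rcases hedge m n hmn s hs t ht h with h | h | h
      exacts [h, absurd h hsa, absurd h hta]
  have aux : ∀ m n, m ≠ n → c m ≠ b m → ∀ t ∈ S n, t ≠ a → c m ≠ t ∧ ¬ G.Adj (c m) t := by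
    intro m n hmn hcm t ht hta
    have := hsep m n hmn (c m) (hcS m) t ht (hca m) hta
    exact ⟨this.1, fun h => hcm (this.2 h).1⟩
  refine ⟨_, isModel_completeBipartiteGraph (X := {a})
    (Y := ((S i \ {a}) \ {c i}) ∪ ((S j \ {a}) \ {c j}))
    (A := ![{c i}, {c j}, S k \ {a}]) (.singleton _) ?_ ?_ ?_ ?_ ?_ ?_ ?_ ?_⟩
  · exact hRi.connectedOn.union hRj.connectedOn hRi.right_mem hRj.right_mem (hbb i j hij)
  · intro m
    fin_cases m
    exacts [.singleton _, .singleton _, (hT k).connectedOn]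
  · rintro _ rfl t (⟨⟨ht, hta⟩, htc⟩ | ⟨⟨ht, hta⟩, htc⟩)
    · exact ⟨fun h => hta h.symm, fun h => htc (hc i t ht h)⟩
    · exact ⟨fun h => hta h.symm, fun h => htc (hc j t ht h)⟩
  · refine fin3_pairs (fun i j h => h.symm) ?_ ?_ ?_
    · rintro _ rfl _ rfl
      exact aux i j hij hcbi _ (hcS j) (hca j)
    · rintro _ rfl t ⟨ht, hta⟩
      exact aux i k hki.symm hcbi t ht hta
    · rintro _ rfl t ⟨ht, hta⟩
      exact aux j k hkj.symm hcbj t ht hta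
  · intro m
    fin_cases m
    exacts [⟨a, rfl, c i, rfl, hac i⟩, ⟨a, rfl, c j, rfl, hac j⟩,
      ⟨a, rfl, c k, (hT k).left_mem, hac k⟩]
  · intro m
    fin_cases m
    exacts [⟨di, Or.inl hRi.left_mem, c i, rfl, hcdi.symm⟩,
      ⟨dj, Or.inr hRj.left_mem, c j, rfl, hcdj.symm⟩,
      ⟨b i, Or.inl hRi.right_mem, b k, (hT k).right_mem, hbb i k hki.symm⟩]
  · intro m
    fin_cases m
    exacts [Set.disjoint_singleton.2 (hca i).symm, Set.disjoint_singleton.2 (hca j).symm,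
      Set.disjoint_singleton_left.2 fun h => h.2 rfl]
  · intro m
    rw [Set.disjoint_right]
    fin_cases m
    · rintro _ rfl (h | h)
      · exact h.2 rfl
      · exact (aux i j hij hcbi _ h.1.1 h.1.2).1 rfl
    · rintro _ rfl (h | h)
      · exact (aux j i hij.symm hcbj _ h.1.1 h.1.2).1 rfl
      · exact h.2 rfl
    · rintro t ⟨ht, hta⟩ (h | h)
      · exact (hsep k i hki t ht t h.1.1 hta hta).1 rfl
      · exact (hsep k j hkj t ht t h.1.1 hta hta).1 rfl

/-- In a long prism whose path `i` is long, a model is given by the edge `a i a j`, the neighbour of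
`a i` on its path, the path `j` without `a j`, the vertex `a k`, and the rest. -/
theorem IsLongPrism.exists_isModel (h : G.IsLongPrism) :
    ∃ B, IsModel (completeBipartiteGraph (Fin 2) (Fin 3)) G B := by
  obtain ⟨a, b, P, hP, ⟨i, hli⟩, hdisj, haa, hbb, hedge, -⟩ := h
  obtain ⟨j, hji, -⟩ := exists_fin3_ne i i
  obtain ⟨k, hki, hkj⟩ := exists_fin3_ne i j
  have hab : ∀ m, a m ≠ b m := fun m => (hP m).1.ne_of_one_le_length (hP m).2.2
  have hnabi : ¬ G.Adj (a i) (b i) := (hP i).2.1.not_adj (hP i).1 hli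
  set S : Fin 3 → Set V := fun i => {w | w ∈ (P i).support} with hS
  have hpath : ∀ i, InducedPath G (a i) (b i) (S i) := fun i => .of_walk _ (hP i).1 (hP i).2.1
  choose c hac hT hc using fun i => (hpath i).tail (hab i)
  have hcbi : c i ≠ b i := fun h => hnabi (h ▸ hac i)
  obtain ⟨d, hcd, hR, -⟩ := (hT i).tail hcbi
  have hsep : ∀ m n, m ≠ n → ∀ s ∈ S m, ∀ t ∈ S n,
      s ≠ t ∧ (G.Adj s t → s = a m ∧ t = a n ∨ s = b m ∧ t = b n) := by
    intro m n hmn s hs t ht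
    refine ⟨?_, hedge m n hmn s hs t ht⟩
    rintro rfl
    exact hdisj m n hmn s hs ht
  have haS : ∀ m, a m ∈ S m := fun m => (hpath m).left_mem
  have hcS : ∀ i, c i ∈ S i := fun i => (hT i).left_mem.1
  have hci : ∀ n, i ≠ n → ∀ t ∈ S n, c i ≠ t ∧ ¬ G.Adj (c i) t := by
    intro n hn t ht
    have := hsep i n hn (c i) (hcS i) t ht
    refine ⟨this.1, fun h => ?_⟩
    rcases this.2 h with h | h
    exacts [(hac i).ne' h.1, hcbi h.1]
  -- An end `a m` has no neighbour on another path apart from the end of that path.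
  have haT : ∀ m n, m ≠ n → ∀ t ∈ S n \ {a n}, a m ≠ t ∧ ¬ G.Adj (a m) t := by
    rintro m n hmn t ⟨ht, hta⟩
    have := hsep m n hmn (a m) (haS m) t ht
    refine ⟨this.1, fun h => ?_⟩
    rcases this.2 h with h | h
    exacts [hta h.2, hab m h.1]
  have haR : ∀ t ∈ (S i \ {a i}) \ {c i}, a i ≠ t ∧ ¬ G.Adj (a i) t :=
    fun t ht => ⟨fun h => ht.1.2 h.symm, fun h => ht.2 (hc i t ht.1.1 h)⟩
  refine ⟨_, isModel_completeBipartiteGraph (X := {a i, a j})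
    (Y := ((S i \ {a i}) \ {c i}) ∪ (S k \ {a k}))
    (A := ![{c i}, S j \ {a j}, {a k}]) ?_ ?_ ?_ ?_ ?_ ?_ ?_ ?_ ?_⟩
  · exact (InducedPath.pair (haa i j hji.symm)).connectedOn
  · exact hR.connectedOn.union (hT k).connectedOn hR.right_mem (hT k).right_mem
      (hbb i k hki.symm)
  · intro m
    fin_cases m
    exacts [.singleton _, (hT j).connectedOn, .singleton _]
  · rintro _ (rfl | rfl) t (ht | ht)
    · exact haR t ht
    · exact haT i k hki.symm t ht
    · exact haT j i hji t ht.1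
    · exact haT j k hkj.symm t ht
  · refine fin3_pairs (fun i j h => h.symm) ?_ ?_ ?_
    · rintro _ rfl t ht
      exact hci j hji.symm t ht.1
    · rintro _ rfl _ rfl
      exact hci k hki.symm _ (haS k)
    · refine Anticomplete.symm ?_
      rintro _ rfl t ht
      exact haT k j hkj t ht
  · intro m
    fin_cases m
    exacts [⟨a i, Or.inl rfl, c i, rfl, hac i⟩, ⟨a j, Or.inr rfl, c j, (hT j).left_mem, hac j⟩,
      ⟨a i, Or.inl rfl, a k, rfl, haa i k hki.symm⟩]
  · intro m
    fin_cases m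
    exacts [⟨d, Or.inl hR.left_mem, c i, rfl, hcd.symm⟩,
      ⟨b i, Or.inl hR.right_mem, b j, (hT j).right_mem, hbb i j hji.symm⟩,
      ⟨c k, Or.inr (hT k).left_mem, a k, rfl, (hac k).symm⟩]
  · intro m
    rw [Set.disjoint_left]
    fin_cases m
    · rintro _ (rfl | rfl) h
      · exact (hac i).ne h
      · exact (hci j hji.symm _ (haS j)).1 (Eq.symm h)
    · rintro _ (rfl | rfl) h
      · exact (haT i j hji.symm _ h).1 rfl
      · exact h.2 rfl
    · rintro _ (rfl | rfl) h
      · exact (haa i k hki.symm).ne h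
      · exact (haa j k hkj.symm).ne h
  · intro m
    rw [Set.disjoint_right]
    fin_cases m
    · rintro _ rfl (h | h)
      · exact h.2 rfl
      · exact (hci k hki.symm _ h.1).1 rfl
    · rintro t ht (h | h)
      · exact (hsep j i hji t ht.1 t h.1.1).1 rfl
      · exact (hsep j k hkj.symm t ht.1 t h.1).1 rfl
    · rintro _ rfl (h | h)
      · exact (haT k i hki _ h.1).1 rfl
      · exact h.2 rfl

/-! ### Holes and sectors -/

/-- The vertices of a path other than its ends form a connected set. -/
theorem Walk.IsPath.connectedOn_interior {a b : V} {p : G.Walk a b} (hp : p.IsPath) :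
    G.ConnectedOn {w | w ∈ p.support ∧ w ≠ a ∧ w ≠ b} := by
  classical
  cases p with
  | nil =>
    rintro w ⟨hw, hwa, -⟩
    simp only [Walk.support_nil, List.mem_singleton] at hw
    exact absurd hw hwa
  | @cons _ c _ h q =>
    rw [Walk.cons_isPath_iff] at hp
    refine .of_root c ?_
    rintro w ⟨hw, hwa, hwb⟩
    rw [Walk.support_cons, List.mem_cons] at hw
    have hwq := hw.resolve_left hwa
    refine (Joined.of_walk (q.takeUntil w hwq) fun t ht => ?_).symm
    have htq := q.support_takeUntil_subset_support hwq ht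
    refine ⟨List.mem_cons_of_mem _ htq, ?_, ?_⟩
    · rintro rfl
      exact hp.2 htq
    · rintro rfl
      exact Walk.endpoint_notMem_support_takeUntil hp.1 hwq hwb.symm ht

/-- Two nonadjacent vertices of a hole split it into two induced paths. -/
theorem Walk.IsCycle.exists_arcs {r u v : V} {C : G.Walk r r} (hC : C.IsCycle) (hch : C.Chordless)
    (hu : u ∈ C.support) (hv : v ∈ C.support) (hne : u ≠ v) (huv : ¬ G.Adj u v) :
    ∃ S T : Set V, InducedPath G u v S ∧ InducedPath G u v T ∧ (∀ w, w ∈ C.support ↔ w ∈ S ∪ T) ∧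
      ∀ s ∈ S, ∀ t ∈ T, s = t ∨ G.Adj s t → s = u ∨ s = v ∨ t = u ∨ t = v := by
  classical
  set C' := C.rotate u hu with hC'
  have hcyc : C'.IsCycle := hC.rotate hu
  have hsup : ∀ w, w ∈ C'.support ↔ w ∈ C.support := fun w => C.mem_support_rotate_iff u hu
  have hch' : C'.Chordless := fun s hs t ht hst =>
    (C.rotate_edges u hu).mem_iff.2 (hch s ((hsup s).1 hs) t ((hsup t).1 ht) hst)
  clear_value C'
  have hv' : v ∈ C'.support := (hsup v).2 hv
  set p := C'.takeUntil v hv' with hp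
  set q := C'.dropUntil v hv' with hq
  have hpq : p.append q = C' := C'.take_spec hv'
  clear_value p q
  subst hpq
  have hpn : ¬ p.Nil := Walk.not_nil_of_ne hne
  have hqp : q.IsPath := hcyc.isPath_of_append_right hpn
  have hpp : p.IsPath := by
    rw [← Walk.isCycle_reverse, Walk.reverse_append] at hcyc
    have := hcyc.isPath_of_append_right (by simpa using Walk.not_nil_of_ne hne.symm)
    exact p.isPath_reverse_iff.1 this
  have hdis : ∀ w, w ∈ p.support → w ∈ q.support → w = u ∨ w = v := by
    intro w hw hw'
    by_contra! hcon
    have h1 : w ∈ p.support.tail := by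
      rw [← p.cons_tail_support, List.mem_cons] at hw
      exact hw.resolve_left hcon.1
    have h2 : w ∈ q.support.tail := by
      rw [← q.cons_tail_support, List.mem_cons] at hw'
      exact hw'.resolve_left hcon.2
    have := hcyc.support_nodup
    rw [Walk.tail_support_append, List.nodup_append] at this
    exact this.2.2 w h1 w h2 rfl
  have hmem : ∀ w, w ∈ (p.append q).support ↔ w ∈ p.support ∨ w ∈ q.support := fun w =>
    Walk.mem_support_append_iff ..
  have hends : ∀ s t, G.Adj s t → (s = u ∨ s = v) → (t = u ∨ t = v) → False := by
    rintro s t hst (rfl | rfl) (rfl | rfl)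
    exacts [hst.ne rfl, huv hst, huv hst.symm, hst.ne rfl]
  have hedge : ∀ s t, (s ∈ p.support ∨ s ∈ q.support) → (t ∈ p.support ∨ t ∈ q.support) →
      G.Adj s t → s(s, t) ∈ p.edges ∨ s(s, t) ∈ q.edges := by
    intro s t hs ht hst
    have := hch' s ((hmem s).2 hs) t ((hmem t).2 ht) hst
    rwa [Walk.edges_append, List.mem_append] at this
  have hpc : p.Chordless := by
    intro s hs t ht hst
    refine (hedge s t (Or.inl hs) (Or.inl ht) hst).resolve_right fun h => ?_
    exact hends s t hst (hdis s hs (q.fst_mem_support_of_mem_edges h))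
      (hdis t ht (q.snd_mem_support_of_mem_edges h))
  have hqc : q.Chordless := by
    intro s hs t ht hst
    refine (hedge s t (Or.inr hs) (Or.inr ht) hst).resolve_left fun h => ?_
    exact hends s t hst (hdis s (p.fst_mem_support_of_mem_edges h) hs)
      (hdis t (p.snd_mem_support_of_mem_edges h) ht)
  refine ⟨{w | w ∈ p.support}, {w | w ∈ q.support}, .of_walk p hpp hpc,
    (InducedPath.of_walk q hqp hqc).reverse, fun w => (hsup w).symm.trans (hmem w), ?_⟩
  rintro s hs t ht (rfl | hst)
  · rcases hdis s hs ht with h | h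
    exacts [Or.inl h, Or.inr (Or.inl h)]
  · rcases hedge s t (Or.inl hs) (Or.inr ht) hst with h | h
    · rcases hdis t (p.snd_mem_support_of_mem_edges h) ht with h | h
      exacts [Or.inr (Or.inr (Or.inl h)), Or.inr (Or.inr (Or.inr h))]
    · rcases hdis s hs (q.fst_mem_support_of_mem_edges h) with h | h
      exacts [Or.inl h, Or.inr (Or.inl h)]

namespace IsSector

variable {r x a b : V} {C : G.Walk r r} {p : G.Walk a b}

theorem support_subset (h : IsSector C x p) {w : V} (hw : w ∈ p.support) : w ∈ C.support := by
  have hn : ¬ p.Nil := Walk.not_nil_iff_lt_length.2 h.2.1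
  obtain ⟨e, he, hwe⟩ := (Walk.mem_support_iff_exists_mem_edges_of_not_nil hn).1 hw
  exact Walk.mem_support_of_mem_edges (h.2.2.1 e he) hwe

/-- At an internal vertex of a sector, the two rim edges are the two edges of the sector. -/
theorem mem_edges (h : IsSector C x p) (hC : C.IsCycle) {w t : V} (hw : w ∈ p.support)
    (hwa : w ≠ a) (hwb : w ≠ b) (hwt : s(w, t) ∈ C.edges) : s(w, t) ∈ p.edges := by
  have hsub : p.toSubgraph.neighborSet w ⊆ C.toSubgraph.neighborSet w := by
    intro s hs
    exact Walk.adj_toSubgraph_iff_mem_edges.2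
      (h.2.2.1 _ (Walk.adj_toSubgraph_iff_mem_edges.1 hs))
  have h2 : (C.toSubgraph.neighborSet w).ncard = 2 :=
    hC.ncard_neighborSet_toSubgraph_eq_two (h.support_subset hw)
  have h1 : (p.toSubgraph.neighborSet w).ncard = 2 := by
    obtain ⟨i, rfl, hi⟩ := Walk.mem_support_iff_exists_getVert.1 hw
    refine h.1.ncard_neighborSet_toSubgraph_internal_eq_two ?_ ?_
    · rintro rfl
      exact hwa p.getVert_zero
    · refine lt_of_le_of_ne hi ?_
      rintro rfl
      exact hwb p.getVert_length
  have heq := Set.eq_of_subset_of_ncard_le hsub (h2.trans h1.symm).le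
    (C.finite_neighborSet_toSubgraph)
  have : t ∈ C.toSubgraph.neighborSet w := Walk.adj_toSubgraph_iff_mem_edges.2 hwt
  rw [← heq] at this
  exact Walk.adj_toSubgraph_iff_mem_edges.1 this

/-- A sector is not left by a path of rim vertices that avoids the neighbours of the center. -/
theorem interior_of_joined (h : IsSector C x p) (hC : C.IsCycle) (hch : C.Chordless) {D : Set V}
    (hDC : ∀ w ∈ D, w ∈ C.support) (hDx : ∀ w ∈ D, ¬ G.Adj x w) {u v : V}
    (hu : u ∈ p.support ∧ u ≠ a ∧ u ≠ b) (huv : G.Joined D u v) :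
    v ∈ p.support ∧ v ≠ a ∧ v ≠ b := by
  refine huv.mem_of_closed (K := {w | w ∈ p.support ∧ w ≠ a ∧ w ≠ b}) hu ?_
  rintro s ⟨hs, hsa, hsb⟩ t ht hst
  have he := h.mem_edges hC hs hsa hsb (hch s (h.support_subset hs) t (hDC t ht) hst)
  refine ⟨p.snd_mem_support_of_mem_edges he, ?_, ?_⟩
  · rintro rfl
    exact hDx t ht h.2.2.2.1
  · rintro rfl
    exact hDx t ht h.2.2.2.2.1

/-- Two sectors with a common internal vertex have the same edges. -/
theorem edges_subset (h : IsSector C x p) (hC : C.IsCycle) (hch : C.Chordless) (hl : 2 ≤ p.length)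
    {c d : V} {q : G.Walk c d} (hq : IsSector C x q) {w : V}
    (hw : w ∈ p.support ∧ w ≠ a ∧ w ≠ b) (hw' : w ∈ q.support ∧ w ≠ c ∧ w ≠ d) {s t : V}
    (hst : s(s, t) ∈ p.edges) : s(s, t) ∈ q.edges := by
  have hint : ∀ z, (z ∈ p.support ∧ z ≠ a ∧ z ≠ b) → z ∈ q.support ∧ z ≠ c ∧ z ≠ d := by
    intro z hz
    refine hq.interior_of_joined hC hch ?_ ?_ hw' (h.1.connectedOn_interior w hw z hz)
    · exact fun t ht => h.support_subset ht.1
    · exact fun t ht => h.2.2.2.2.2 t ht.1 ht.2.1 ht.2.2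
  have key : ∀ s t, s(s, t) ∈ p.edges → s ≠ a → s ≠ b → s(s, t) ∈ q.edges := by
    intro s t hst hsa hsb
    obtain ⟨h1, h2, h3⟩ := hint s ⟨p.fst_mem_support_of_mem_edges hst, hsa, hsb⟩
    exact hq.mem_edges hC h1 h2 h3 (h.2.2.1 _ hst)
  by_cases hs : s ≠ a ∧ s ≠ b
  · exact key s t hst hs.1 hs.2
  by_cases ht : t ≠ a ∧ t ≠ b
  · rw [Sym2.eq_swap] at hst ⊢
    exact key t s hst ht.1 ht.2
  -- An edge joining the two ends would make `p` a single edge.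
  exfalso
  have hab : s(a, b) ∈ p.edges := by
    have hadj := p.adj_of_mem_edges hst
    have hsab : s = a ∨ s = b := by tauto
    have htab : t = a ∨ t = b := by tauto
    rcases hsab with rfl | rfl <;> rcases htab with rfl | rfl
    · exact absurd rfl hadj.ne
    · exact hst
    · rwa [Sym2.eq_swap]
    · exact absurd rfl hadj.ne
  have := h.1.length_eq_one_of_mem_edges hab
  lia

theorem toSubgraph_le (h : IsSector C x p) (hC : C.IsCycle) (hch : C.Chordless) (hl : 2 ≤ p.length)
    {c d : V} {q : G.Walk c d} (hq : IsSector C x q) {w : V}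
    (hw : w ∈ p.support ∧ w ≠ a ∧ w ≠ b) (hw' : w ∈ q.support ∧ w ≠ c ∧ w ≠ d) :
    p.toSubgraph ≤ q.toSubgraph := by
  rw [Walk.toSubgraph_le_iff (Walk.not_nil_iff_lt_length.2 h.2.1)]
  intro e he
  induction e with
  | _ s t => exact q.mem_edges_toSubgraph.2 (h.edges_subset hC hch hl hq hw hw' he)

theorem exists_interior (h : IsSector C x p) (hl : 2 ≤ p.length) :
    ∃ w, w ∈ p.support ∧ w ≠ a ∧ w ≠ b := by
  have hp := h.1
  cases p with
  | nil => simp at hl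
  | @cons _ e _ hae q =>
    rw [Walk.cons_isPath_iff] at hp
    exact ⟨e, by simp, hae.ne', hp.1.ne_of_one_le_length (by simpa using hl)⟩

end IsSector

/-- In a broken wheel, take internal vertices `u`, `v` of two long sectors: a model is given by the
center, `u`, `v`, and the two arcs of the rim between `u` and `v`. Both arcs contain a neighbour of
the center, as otherwise the two sectors would coincide. -/
theorem IsBrokenWheel.exists_isModel (h : G.IsBrokenWheel) :
    ∃ B, IsModel (completeBipartiteGraph (Fin 2) (Fin 3)) G B := by
  obtain ⟨r, C, x, ⟨⟨hC, hch, -⟩, hxC, -, -⟩, a, b, c, d, p, q, hp, hq, hlp, hlq, hpq⟩ := h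
  obtain ⟨u, hu⟩ := hp.exists_interior hlp
  obtain ⟨v, hv⟩ := hq.exists_interior hlq
  have huC := hp.support_subset hu.1
  have hvC := hq.support_subset hv.1
  have hxu : ¬ G.Adj x u := hp.2.2.2.2.2 u hu.1 hu.2.1 hu.2.2
  have hxv : ¬ G.Adj x v := hq.2.2.2.2.2 v hv.1 hv.2.1 hv.2.2
  have hnj : ∀ D : Set V, (∀ w ∈ D, w ∈ C.support) → G.Joined D u v → ∃ w ∈ D, G.Adj x w := by
    intro D hD huv
    by_contra! hcon
    have hv' := hp.interior_of_joined hC hch hD hcon hu huv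
    exact hpq (le_antisymm (hp.toSubgraph_le hC hch hlp hq hv' hv)
      (hq.toSubgraph_le hC hch hlq hp hv hv'))
  have huv : u ≠ v := by
    rintro rfl
    obtain ⟨w, rfl, hw⟩ := hnj {u} (by rintro _ rfl; exact huC) (.refl rfl)
    exact hxu hw
  have hnuv : ¬ G.Adj u v := by
    intro h
    obtain ⟨w, rfl | rfl, hw⟩ := hnj {u, v} (by rintro _ (rfl | rfl) <;> assumption)
      (.of_adj h (Or.inl rfl) (Or.inr rfl))
    exacts [hxu hw, hxv hw]
  obtain ⟨S, T, hS, hT, hST, hcross⟩ := hC.exists_arcs hch huC hvC huv hnuv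
  have hnbr : ∀ R : Set V, (∀ w ∈ R, w ∈ C.support) → InducedPath G u v R →
      ∃ w ∈ R \ {u, v}, G.Adj x w := by
    intro R hR hP
    obtain ⟨w, hw, hxw⟩ := hnj R hR ⟨R, subset_rfl, hP⟩
    refine ⟨w, ⟨hw, ?_⟩, hxw⟩
    rintro (rfl | rfl)
    exacts [hxu hxw, hxv hxw]
  have hSC : ∀ w ∈ S, w ∈ C.support := fun w hw => (hST w).2 (Or.inl hw)
  have hTC : ∀ w ∈ T, w ∈ C.support := fun w hw => (hST w).2 (Or.inr hw)
  obtain ⟨s, hs, hxs⟩ := hnbr S hSC hS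
  obtain ⟨t, ht, hxt⟩ := hnbr T hTC hT
  obtain ⟨s₁, s₂, hS', hs₁, hs₂⟩ := hS.interior huv hnuv
  obtain ⟨t₁, t₂, hT', ht₁, ht₂⟩ := hT.interior huv hnuv
  have hne : ∀ w, w ∈ C.support → x ≠ w := fun w hw h => hxC (h ▸ hw)
  refine ⟨_, isModel_completeBipartiteGraph (X := S \ {u, v}) (Y := T \ {u, v})
    (A := ![{x}, {u}, {v}]) hS'.connectedOn hT'.connectedOn ?_ ?_ ?_ ?_ ?_ ?_ ?_⟩
  · intro m
    fin_cases m
    exacts [.singleton _, .singleton _, .singleton _]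
  · rintro s ⟨hs, hs'⟩ t ⟨ht, ht'⟩
    simp only [Set.mem_insert_iff, Set.mem_singleton_iff, not_or] at hs' ht'
    have := hcross s hs t ht
    tauto
  · refine fin3_pairs (fun i j h => h.symm) ?_ ?_ ?_
    · rintro _ rfl _ rfl
      exact ⟨hne _ huC, hxu⟩
    · rintro _ rfl _ rfl
      exact ⟨hne _ hvC, hxv⟩
    · rintro _ rfl _ rfl
      exact ⟨huv, hnuv⟩
  · intro m
    fin_cases m
    exacts [⟨s, hs, x, rfl, hxs.symm⟩, ⟨s₁, hS'.left_mem, u, rfl, hs₁.symm⟩,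
      ⟨s₂, hS'.right_mem, v, rfl, hs₂.symm⟩]
  · intro m
    fin_cases m
    exacts [⟨t, ht, x, rfl, hxt.symm⟩, ⟨t₁, hT'.left_mem, u, rfl, ht₁.symm⟩,
      ⟨t₂, hT'.right_mem, v, rfl, ht₂.symm⟩]
  · intro m
    rw [Set.disjoint_right]
    fin_cases m
    · rintro _ rfl h
      exact hne _ (hSC _ h.1) rfl
    · rintro _ rfl h
      exact h.2 (Or.inl rfl)
    · rintro _ rfl h
      exact h.2 (Or.inr rfl)
  · intro m
    rw [Set.disjoint_right]
    fin_cases m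
    · rintro _ rfl h
      exact hne _ (hTC _ h.1) rfl
    · rintro _ rfl h
      exact h.2 (Or.inl rfl)
    · rintro _ rfl h
      exact h.2 (Or.inr rfl)

/-! ### Recognizing the four configurations -/

theorem InducedPath.induce {a b : V} {S D : Set V} (h : InducedPath G a b S) (hS : S ⊆ D) :
    InducedPath (G.induce D) ⟨a, hS h.left_mem⟩ ⟨b, hS h.right_mem⟩ (Subtype.val ⁻¹' S) := by
  induction h with
  | single a =>
    convert InducedPath.single (G := G.induce D) ⟨a, hS rfl⟩ using 1
    ext ⟨w, hw⟩
    simp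
  | @cons a b c S hab h ha hadj ih =>
    have hS' : S ⊆ D := fun w hw => hS (Or.inr hw)
    have hadj' : (G.induce D).Adj ⟨a, hS (Or.inl rfl)⟩ ⟨b, hS' h.left_mem⟩ := hab
    convert InducedPath.cons hadj' (ih hS') ha
      (fun t ht hat => Subtype.ext (hadj t ht hat)) using 1
    ext ⟨w, hw⟩
    simp

/-- An induced path inside `D`, as a walk of the subgraph induced by `D`. -/
theorem InducedPath.exists_walk_induce {a b : V} {S D : Set V} (h : InducedPath G a b S)
    (hS : S ⊆ D) :
    ∃ p : (G.induce D).Walk ⟨a, hS h.left_mem⟩ ⟨b, hS h.right_mem⟩, p.IsPath ∧ p.Chordless ∧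
      (∀ w, w ∈ p.support ↔ w.1 ∈ S) ∧ (a ≠ b → 1 ≤ p.length) ∧
      (a ≠ b → ¬ G.Adj a b → 2 ≤ p.length) := by
  obtain ⟨p, hp, hc, hsup⟩ := (h.induce hS).exists_walk
  have h1 : a ≠ b → 1 ≤ p.length := by
    intro hab
    exact Walk.not_nil_iff_lt_length.1 (Walk.not_nil_of_ne fun h => hab (Subtype.ext_iff.1 h))
  refine ⟨p, hp, hc, hsup, h1, fun hab hnab => ?_⟩
  have h1' := h1 hab
  by_contra hlt
  have hadj := p.adj_of_length_eq_one (by lia)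
  exact hnab hadj

theorem isTheta_induce {a b : V} {S : Fin 3 → Set V} (hS : ∀ i, InducedPath G a b (S i))
    (hab : a ≠ b) (hnab : ¬ G.Adj a b)
    (hcross : ∀ i j, i ≠ j → ∀ s ∈ S i, ∀ t ∈ S j, s = t ∨ G.Adj s t →
      s = a ∨ s = b ∨ t = a ∨ t = b) : (G.induce (⋃ i, S i)).IsTheta := by
  choose P hP hc hsup _ hl using fun i => (hS i).exists_walk_induce (Set.subset_iUnion S i)
  refine ⟨⟨a, Set.mem_iUnion_of_mem 0 (hS 0).left_mem⟩,
    ⟨b, Set.mem_iUnion_of_mem 0 (hS 0).right_mem⟩, P,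
    fun i => ⟨hP i, hc i, hl i hab hnab⟩, ?_, ?_, ?_⟩
  · intro i j hij w hw hw'
    have := hcross i j hij w ((hsup i w).1 hw) w ((hsup j w).1 hw') (Or.inl rfl)
    simp only [Subtype.ext_iff]
    tauto
  · intro i j hij s hs t ht hst
    simp only [Subtype.ext_iff]
    exact hcross i j hij s ((hsup i s).1 hs) t ((hsup j t).1 ht) (Or.inr hst)
  · rintro ⟨w, hw⟩
    obtain ⟨i, hi⟩ := Set.mem_iUnion.1 hw
    exact ⟨i, (hsup i _).2 hi⟩

theorem isPyramid_induce {a : V} {b : Fin 3 → V} {S : Fin 3 → Set V}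
    (hS : ∀ i, InducedPath G a (b i) (S i)) (hab : ∀ i, a ≠ b i)
    (hnab : ∃ k, ∀ i, i ≠ k → ¬ G.Adj a (b i)) (hbb : ∀ i j, i ≠ j → G.Adj (b i) (b j))
    (hcross : ∀ i j, i ≠ j → ∀ s ∈ S i, ∀ t ∈ S j, s = t ∨ G.Adj s t →
      (s = b i ∧ t = b j) ∨ s = a ∨ t = a) : (G.induce (⋃ i, S i)).IsPyramid := by
  choose P hP hc hsup hl1 hl using fun i => (hS i).exists_walk_induce (Set.subset_iUnion S i)
  refine ⟨⟨a, Set.mem_iUnion_of_mem 0 (hS 0).left_mem⟩,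
    fun i => ⟨b i, Set.mem_iUnion_of_mem i (hS i).right_mem⟩, P,
    fun i => ⟨hP i, hc i, hl1 i (hab i)⟩, ?_, ?_, hbb, ?_, ?_⟩
  · obtain ⟨k, hk⟩ := hnab
    obtain ⟨i, hik, -⟩ := exists_fin3_ne k k
    obtain ⟨j, hji, hjk⟩ := exists_fin3_ne i k
    exact ⟨i, j, hji.symm, hl i (hab i) (hk i hik), hl j (hab j) (hk j hjk)⟩
  · intro i j hij w hw hw'
    rcases hcross i j hij w ((hsup i w).1 hw) w ((hsup j w).1 hw') (Or.inl rfl) with h | h | h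
    · exact absurd (h.1.symm.trans h.2) (hbb i j hij).ne
    · exact Subtype.ext h
    · exact Subtype.ext h
  · intro i j hij s hs t ht hst
    simp only [Subtype.ext_iff]
    exact hcross i j hij s ((hsup i s).1 hs) t ((hsup j t).1 ht) (Or.inr hst)
  · rintro ⟨w, hw⟩
    obtain ⟨i, hi⟩ := Set.mem_iUnion.1 hw
    exact ⟨i, (hsup i _).2 hi⟩

theorem isLongPrism_induce {a b : Fin 3 → V} {S : Fin 3 → Set V}
    (hS : ∀ i, InducedPath G (a i) (b i) (S i)) (hab : ∀ i, a i ≠ b i)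
    (hnab : ∃ i, ¬ G.Adj (a i) (b i)) (haa : ∀ i j, i ≠ j → G.Adj (a i) (a j))
    (hbb : ∀ i j, i ≠ j → G.Adj (b i) (b j))
    (hcross : ∀ i j, i ≠ j → ∀ s ∈ S i, ∀ t ∈ S j, s = t ∨ G.Adj s t →
      (s = a i ∧ t = a j) ∨ (s = b i ∧ t = b j)) : (G.induce (⋃ i, S i)).IsLongPrism := by
  choose P hP hc hsup hl1 hl using fun i => (hS i).exists_walk_induce (Set.subset_iUnion S i)
  refine ⟨fun i => ⟨a i, Set.mem_iUnion_of_mem i (hS i).left_mem⟩,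
    fun i => ⟨b i, Set.mem_iUnion_of_mem i (hS i).right_mem⟩, P,
    fun i => ⟨hP i, hc i, hl1 i (hab i)⟩, ?_, ?_, haa, hbb, ?_, ?_⟩
  · obtain ⟨i, hi⟩ := hnab
    exact ⟨i, hl i (hab i) hi⟩
  · intro i j hij w hw hw'
    rcases hcross i j hij w ((hsup i w).1 hw) w ((hsup j w).1 hw') (Or.inl rfl) with h | h
    · exact absurd (h.1.symm.trans h.2) (haa i j hij).ne
    · exact absurd (h.1.symm.trans h.2) (hbb i j hij).ne
  · intro i j hij s hs t ht hst
    simp only [Subtype.ext_iff]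
    exact hcross i j hij s ((hsup i s).1 hs) t ((hsup j t).1 ht) (Or.inr hst)
  · rintro ⟨w, hw⟩
    obtain ⟨i, hi⟩ := Set.mem_iUnion.1 hw
    exact ⟨i, (hsup i _).2 hi⟩

/-- The vertex set `A` is a sector of length at least two for the center `z`, from `p` to `q`. -/
def IsLongSector (G : SimpleGraph V) (z p q : V) (A : Set V) : Prop :=
  InducedPath G p q A ∧ p ≠ q ∧ ¬ G.Adj p q ∧ G.Adj z p ∧ G.Adj z q ∧
    ∀ w ∈ A, w ≠ p → w ≠ q → ¬ G.Adj z w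

/-- The union of two induced paths `S`, `T` with the same ends is a hole when no edge joins their
interiors; a vertex `z` outside with three neighbours on it and two long sectors completes a broken
wheel. -/
theorem isBrokenWheel_induce {z u v : V} {S T : Set V} (hS : InducedPath G u v S)
    (hT : InducedPath G u v T) (huv : u ≠ v) (hnuv : ¬ G.Adj u v)
    (hcross : ∀ s ∈ S, ∀ t ∈ T, s = t ∨ G.Adj s t → s = u ∨ s = v ∨ t = u ∨ t = v)
    (hz : z ∉ S ∪ T)
    {x₁ x₂ x₃ : V} (hx₁ : x₁ ∈ S ∪ T) (hx₂ : x₂ ∈ S ∪ T) (hx₃ : x₃ ∈ S ∪ T)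
    (hzx₁ : G.Adj z x₁) (hzx₂ : G.Adj z x₂) (hzx₃ : G.Adj z x₃)
    (h12 : x₁ ≠ x₂) (h13 : x₁ ≠ x₃) (h23 : x₂ ≠ x₃)
    {a b c d : V} {A B : Set V} (hA : G.IsLongSector z a b A) (hB : G.IsLongSector z c d B)
    (hAS : A ⊆ S ∪ T) (hBS : B ⊆ S ∪ T) (hAB : A ≠ B) :
    (G.induce (insert z (S ∪ T))).IsBrokenWheel := by
  set D := insert z (S ∪ T) with hD
  have hSD : S ∪ T ⊆ D := Set.subset_insert _ _
  obtain ⟨p, hp, hpc, hps, -, hpl⟩ :=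
    hS.exists_walk_induce (Set.subset_union_left.trans hSD)
  obtain ⟨q, hq, hqc, hqs, -, hql⟩ :=
    hT.reverse.exists_walk_induce (Set.subset_union_right.trans hSD)
  have hcyc : (p.append q).IsCycle := by
    refine hp.isCycle_append hq ?_ (Or.inl (hpl huv hnuv))
    intro w hw hw'
    have h1 := hp.support_nodup
    have h2 := hq.support_nodup
    rw [← Walk.cons_tail_support, List.nodup_cons] at h1 h2
    have hwu : w.1 ≠ u := fun h => h1.1 (by convert hw; exact h.symm)
    have hwv : w.1 ≠ v := fun h => h2.1 (by convert hw'; exact h.symm)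
    have := hcross w ((hps w).1 (List.mem_of_mem_tail hw)) w
      ((hqs w).1 (List.mem_of_mem_tail hw')) (Or.inl rfl)
    tauto
  have hsup : ∀ w, w ∈ (p.append q).support ↔ w.1 ∈ S ∪ T := fun w => by
    rw [Walk.mem_support_append_iff, hps, hqs, Set.mem_union]
  have hch : (p.append q).Chordless := by
    intro s hs t ht hst
    rw [Walk.edges_append, List.mem_append]
    rw [hsup] at hs ht
    have key : ∀ s t : D, s.1 ∈ S → t.1 ∈ T → (G.induce D).Adj s t →
        s(s, t) ∈ p.edges ∨ s(s, t) ∈ q.edges := by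
      intro s t hs ht hst
      have hu : u ∈ S ∧ u ∈ T := ⟨hS.left_mem, hT.left_mem⟩
      have hv : v ∈ S ∧ v ∈ T := ⟨hS.right_mem, hT.right_mem⟩
      have h4 : s.1 ∈ T ∨ t.1 ∈ S := by
        rcases hcross s hs t ht (Or.inr hst) with h | h | h | h
        exacts [Or.inl (h ▸ hu.2), Or.inl (h ▸ hv.2), Or.inr (h ▸ hu.1), Or.inr (h ▸ hv.1)]
      rcases h4 with h | h
      · exact Or.inr (hqc s ((hqs s).2 h) t ((hqs t).2 ht) hst)
      · exact Or.inl (hpc s ((hps s).2 hs) t ((hps t).2 h) hst)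
    rcases hs with hs | hs <;> rcases ht with ht | ht
    · exact Or.inl (hpc s ((hps s).2 hs) t ((hps t).2 ht) hst)
    · exact key s t hs ht hst
    · rw [Sym2.eq_swap]
      exact key t s ht hs hst.symm
    · exact Or.inr (hqc s ((hqs s).2 hs) t ((hqs t).2 ht) hst)
  have hsec : ∀ {a b : V} {A : Set V} (hA : G.IsLongSector z a b A) (hAS : A ⊆ S ∪ T),
      ∃ r : (G.induce D).Walk ⟨a, hSD (hAS hA.1.left_mem)⟩ ⟨b, hSD (hAS hA.1.right_mem)⟩,
        IsSector (p.append q) ⟨z, Set.mem_insert _ _⟩ r ∧ 2 ≤ r.length ∧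
          ∀ w, w ∈ r.support ↔ w.1 ∈ A := by
    intro a b A hA hAS
    obtain ⟨r, hr, -, hrs, -, hrl⟩ := hA.1.exists_walk_induce (hAS.trans hSD)
    have hl := hrl hA.2.1 hA.2.2.1
    refine ⟨r, ⟨hr, by lia, ?_, hA.2.2.2.1, hA.2.2.2.2.1, ?_⟩, hl, hrs⟩
    · intro e he
      induction e with
      | _ s t =>
        refine hch s ?_ t ?_ (r.adj_of_mem_edges he)
        · exact (hsup s).2 (hAS ((hrs s).1 (r.fst_mem_support_of_mem_edges he)))
        · exact (hsup t).2 (hAS ((hrs t).1 (r.snd_mem_support_of_mem_edges he)))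
    · intro w hw hwa hwb
      exact hA.2.2.2.2.2 w ((hrs w).1 hw) (fun h => hwa (Subtype.ext h))
        fun h => hwb (Subtype.ext h)
  obtain ⟨r, hr, hrl, hrs⟩ := hsec hA hAS
  obtain ⟨r', hr', hrl', hrs'⟩ := hsec hB hBS
  refine ⟨_, p.append q, ⟨z, Set.mem_insert _ _⟩, ⟨⟨hcyc, hch, ?_⟩, ?_, ?_, ?_⟩, _, _, _, _, r, r',
    hr, hr', hrl, hrl', ?_⟩
  · rw [Walk.length_append]
    have := hpl huv hnuv
    have := hql huv.symm fun h => hnuv h.symm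
    lia
  · rw [hsup]
    exact hz
  · rintro ⟨w, rfl | hw⟩
    · exact Or.inl rfl
    · exact Or.inr ((hsup _).2 hw)
  · have hfin : {w : D | w ∈ (p.append q).support ∧
        (G.induce D).Adj ⟨z, Set.mem_insert _ _⟩ w}.Finite :=
      (p.append q).support.finite_toSet.subset fun w hw => hw.1
    have h3 : ({⟨x₁, hSD hx₁⟩, ⟨x₂, hSD hx₂⟩, ⟨x₃, hSD hx₃⟩} : Set D).ncard = 3 :=
      Set.ncard_eq_three.2 ⟨_, _, _, by simpa using h12, by simpa using h13, by simpa using h23, rfl⟩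
    rw [← h3]
    refine Set.ncard_le_ncard ?_ hfin
    rintro _ (rfl | rfl | rfl)
    exacts [⟨(hsup _).2 hx₁, hzx₁⟩, ⟨(hsup _).2 hx₂, hzx₂⟩, ⟨(hsup _).2 hx₃, hzx₃⟩]
  · intro heq
    apply hAB
    ext w
    have hmem : ∀ w, w ∈ r.support ↔ w ∈ r'.support := fun w => by
      rw [← Walk.mem_verts_toSubgraph, heq, Walk.mem_verts_toSubgraph]
    constructor
    · intro hw
      exact (hrs' ⟨w, hSD (hAS hw)⟩).1 ((hmem _).1 ((hrs _).2 hw))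
    · intro hw
      exact (hrs ⟨w, hSD (hBS hw)⟩).1 ((hmem _).2 ((hrs' _).2 hw))

/-! ### Connecting three terminals -/

/-- A subdivided claw with center `c` and legs `L i` ending at the terminals `v i`.  A leg may be
trivial, when `c` is itself a terminal. -/
def IsSpider (G : SimpleGraph V) (v : Fin 3 → V) (c : V) (L : Fin 3 → Set V) : Prop :=
  (∀ i, InducedPath G c (v i) (L i)) ∧
    ∀ i j, i ≠ j → ∀ s ∈ L i, ∀ t ∈ L j, s = t ∨ G.Adj s t → s = c ∨ t = c

/-- A triangle with corners `b i` and legs `L i` ending at the terminals `v i` (the line graph of a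
subdivided claw).  A leg is trivial when `b i = v i`. -/
def IsNet (G : SimpleGraph V) (v b : Fin 3 → V) (L : Fin 3 → Set V) : Prop :=
  (∀ i, InducedPath G (b i) (v i) (L i)) ∧ (∀ i j, i ≠ j → G.Adj (b i) (b j)) ∧
    ∀ i j, i ≠ j → ∀ s ∈ L i, ∀ t ∈ L j, s = t ∨ G.Adj s t → s = b i ∧ t = b j

theorem IsSpider.of_pairs {v : Fin 3 → V} {c : V} {L : Fin 3 → Set V}
    (h : ∀ i, InducedPath G c (v i) (L i))
    (h01 : ∀ s ∈ L 0, ∀ t ∈ L 1, s = t ∨ G.Adj s t → s = c ∨ t = c)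
    (h02 : ∀ s ∈ L 0, ∀ t ∈ L 2, s = t ∨ G.Adj s t → s = c ∨ t = c)
    (h12 : ∀ s ∈ L 1, ∀ t ∈ L 2, s = t ∨ G.Adj s t → s = c ∨ t = c) : G.IsSpider v c L :=
  ⟨h, fin3_pairs (fun _ _ h s hs t ht hst =>
    (h t ht s hs (hst.imp Eq.symm fun h => h.symm)).symm) h01 h02 h12⟩

theorem IsNet.of_pairs {v b : Fin 3 → V} {L : Fin 3 → Set V}
    (h : ∀ i, InducedPath G (b i) (v i) (L i)) (hb01 : G.Adj (b 0) (b 1))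
    (hb02 : G.Adj (b 0) (b 2)) (hb12 : G.Adj (b 1) (b 2))
    (h01 : ∀ s ∈ L 0, ∀ t ∈ L 1, s = t ∨ G.Adj s t → s = b 0 ∧ t = b 1)
    (h02 : ∀ s ∈ L 0, ∀ t ∈ L 2, s = t ∨ G.Adj s t → s = b 0 ∧ t = b 2)
    (h12 : ∀ s ∈ L 1, ∀ t ∈ L 2, s = t ∨ G.Adj s t → s = b 1 ∧ t = b 2) : G.IsNet v b L :=
  ⟨h, fin3_pairs (fun _ _ h => h.symm) hb01 hb02 hb12,
    fin3_pairs (fun _ _ h s hs t ht hst =>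
      (h t ht s hs (hst.imp Eq.symm fun h => h.symm)).symm) h01 h02 h12⟩

/-- Three vertices of a connected set are connected inside it by an induced spider or net: join two
of them by an induced path, reach that path from the third one, and look at the first and the last
neighbour on the path of the vertex `s` from which it is reached. -/
theorem ConnectedOn.exists_spider_or_net {W : Set V} (hW : G.ConnectedOn W) {v : Fin 3 → V}
    (hv : ∀ i, v i ∈ W) :
    (∃ c L, G.IsSpider v c L ∧ ∀ i, L i ⊆ W) ∨ ∃ b L, G.IsNet v b L ∧ ∀ i, L i ⊆ W := by
  obtain ⟨S, hSW, hS⟩ := hW _ (hv 0) _ (hv 1)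
  by_cases h2 : v 2 ∈ S
  · obtain ⟨S₁, S₂, hS₁, hS₂, rfl, hcross⟩ := hS.split h2
    refine Or.inl ⟨v 2, ![S₁, S₂, {v 2}], .of_pairs ?_ hcross ?_ ?_, ?_⟩
    · intro i
      fin_cases i
      exacts [hS₁.reverse, hS₂, .single _]
    · rintro s - t rfl -
      exact Or.inr rfl
    · rintro s - t rfl -
      exact Or.inr rfl
    · intro i
      fin_cases i
      exacts [Set.subset_union_left.trans hSW, Set.subset_union_right.trans hSW,
        Set.singleton_subset_iff.2 (hv 2)]
  obtain ⟨T₀, hTW, hT₀⟩ := hW _ (hv 2) _ (hv 0)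
  obtain ⟨s, T, T', hT, -, rfl, -, hs, hTs⟩ := hT₀.exists_first
    (fun u => u ∈ S ∨ ∃ t ∈ S, G.Adj u t) ⟨v 0, hT₀.right_mem, Or.inl hS.left_mem⟩
  have hTW' : T ⊆ W := Set.subset_union_left.trans hTW
  have hsS : s ∉ S := by
    intro hsS
    have hne : v 2 ≠ s := fun h => h2 (h ▸ hsS)
    obtain ⟨c, hc, hsc⟩ := hT.exists_adj_right hne
    exact hsc.ne (hTs c hc (Or.inr ⟨s, hsS, hsc.symm⟩)).symm
  have hST : ∀ x ∈ S, ∀ y ∈ T, x = y ∨ G.Adj x y → y = s ∧ G.Adj s x := by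
    rintro x hx y hy (rfl | hxy)
    · exact absurd (hTs x hy (Or.inl hx) ▸ hx) hsS
    · obtain rfl := hTs y hy (Or.inr ⟨x, hx, hxy.symm⟩)
      exact ⟨rfl, hxy.symm⟩
  obtain ⟨p, q, S₁, S₀, S₂, hS₁, hS₀, hS₂, rfl, hp, hq, hp₁, hq₂, hc₁, hc₂⟩ :=
    hS.exists_first_last (G.Adj s) (hs.resolve_left hsS)
  have hm₁ : ∀ x ∈ S₁, x ∈ S₁ ∪ S₀ ∪ S₂ := fun x hx => Or.inl (Or.inl hx)
  have hm₂ : ∀ x ∈ S₂, x ∈ S₁ ∪ S₀ ∪ S₂ := fun x hx => Or.inr hx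
  by_cases hpq : p = q
  · subst hpq
    have hpT : p ∉ T := fun h =>
      absurd (hST p (hm₁ p hS₁.right_mem) p h (Or.inl rfl)).1 hp.ne'
    refine Or.inl ⟨p, ![S₁, S₂, insert p T], .of_pairs ?_ ?_ ?_ ?_, ?_⟩
    · intro i
      fin_cases i
      exacts [hS₁.reverse, hS₂, .cons hp.symm hT.reverse hpT fun t ht hpt =>
        (hST p (hm₁ p hS₁.right_mem) t ht (Or.inr hpt)).1]
    · exact fun x hx y hy => hc₁ x hx y (Or.inr hy)
    · rintro x hx y (rfl | hy) hxy
      · exact Or.inr rfl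
      · exact Or.inl (hp₁ x hx (hST x (hm₁ x hx) y hy hxy).2)
    · rintro x hx y (rfl | hy) hxy
      · exact Or.inr rfl
      · exact Or.inl (hq₂ x hx (hST x (hm₂ x hx) y hy hxy).2)
    · intro i
      fin_cases i
      exacts [fun x hx => hSW (hm₁ x hx), fun x hx => hSW (hm₂ x hx),
        Set.insert_subset (hSW (hm₁ p hS₁.right_mem)) hTW']
  have hc : ∀ x ∈ S₁, ∀ y ∈ S₂, x = y ∨ G.Adj x y → x = p ∧ y = q := by
    intro x hx y hy hxy
    have hpS₂ : p ∉ S₂ := fun h => (hpq (hq₂ p h hp)).elim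
    have hqS₁ : q ∉ S₁ := fun h => (hpq (hp₁ q h hq).symm).elim
    constructor
    · exact (hc₁ x hx y (Or.inr hy) hxy).resolve_right fun h => hpS₂ (h ▸ hy)
    · exact (hc₂ x (Or.inl hx) y hy hxy).resolve_left fun h => hqS₁ (h ▸ hx)
  by_cases hadj : G.Adj p q
  · refine Or.inr ⟨![p, q, s], ![S₁, S₂, T], .of_pairs ?_ hadj hp.symm hq.symm hc ?_ ?_, ?_⟩
    · intro i
      fin_cases i
      exacts [hS₁.reverse, hS₂, hT.reverse]
    · intro x hx y hy hxy
      obtain ⟨h1, h2⟩ := hST x (hm₁ x hx) y hy hxy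
      exact ⟨hp₁ x hx h2, h1⟩
    · intro x hx y hy hxy
      obtain ⟨h1, h2⟩ := hST x (hm₂ x hx) y hy hxy
      exact ⟨hq₂ x hx h2, h1⟩
    · intro i
      fin_cases i
      exacts [fun x hx => hSW (hm₁ x hx), fun x hx => hSW (hm₂ x hx), hTW']
  · refine Or.inl ⟨s, ![insert s S₁, insert s S₂, T], .of_pairs ?_ ?_ ?_ ?_, ?_⟩
    · intro i
      fin_cases i
      exacts [.cons hp hS₁.reverse (fun h => hsS (hm₁ s h)) hp₁,
        .cons hq hS₂ (fun h => hsS (hm₂ s h)) hq₂, hT.reverse]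
    · rintro x (rfl | hx) y (rfl | hy) hxy
      · exact Or.inl rfl
      · exact Or.inl rfl
      · exact Or.inr rfl
      · obtain ⟨rfl, rfl⟩ := hc x hx y hy hxy
        exact (hxy.elim hpq hadj).elim
    · rintro x (rfl | hx) y hy hxy
      · exact Or.inl rfl
      · exact Or.inr (hST x (hm₁ x hx) y hy hxy).1
    · rintro x (rfl | hx) y hy hxy
      · exact Or.inl rfl
      · exact Or.inr (hST x (hm₂ x hx) y hy hxy).1
    · intro i
      have hsW : s ∈ W := hTW' hT.right_mem
      fin_cases i
      exacts [Set.insert_subset hsW fun x hx => hSW (hm₁ x hx),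
        Set.insert_subset hsW fun x hx => hSW (hm₂ x hx), hTW']

/-- The connected set `X` avoids the three terminals `v i` and contains a neighbour of each. -/
structure IsAttached (G : SimpleGraph V) (v : Fin 3 → V) (X : Set V) : Prop where
  connectedOn : G.ConnectedOn X
  notMem : ∀ i, v i ∉ X
  exists_adj : ∀ i, ∃ t ∈ X, G.Adj (v i) t

/-- Some induced path through `X` between the two terminals other than `v k` contains at least one
neighbour of `v k`. -/
def SeesOne (G : SimpleGraph V) (v : Fin 3 → V) (X : Set V) (k : Fin 3) : Prop :=
  ∃ i j S, i ≠ j ∧ k ≠ i ∧ k ≠ j ∧ InducedPath G (v i) (v j) S ∧ S ⊆ X ∪ {v i, v j} ∧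
    ∃ p ∈ S, G.Adj (v k) p

/-- Some induced path through `X` between the two terminals other than `v k` contains at least two
neighbours of `v k`. -/
def SeesTwo (G : SimpleGraph V) (v : Fin 3 → V) (X : Set V) (k : Fin 3) : Prop :=
  ∃ i j S, i ≠ j ∧ k ≠ i ∧ k ≠ j ∧ InducedPath G (v i) (v j) S ∧ S ⊆ X ∪ {v i, v j} ∧
    ∃ p ∈ S, ∃ q ∈ S, p ≠ q ∧ G.Adj (v k) p ∧ G.Adj (v k) q

theorem SeesTwo.seesOne {v : Fin 3 → V} {X : Set V} {k : Fin 3} (h : G.SeesTwo v X k) :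
    G.SeesOne v X k :=
  let ⟨i, j, S, h1, h2, h3, h4, h5, p, hp, _, _, _, hkp, _⟩ := h
  ⟨i, j, S, h1, h2, h3, h4, h5, p, hp, hkp⟩

theorem ConnectedOn.exists_inducedPath_through {X : Set V} (hX : G.ConnectedOn X) {a b : V}
    (ha : a ∉ X) (hb : b ∉ X) (hab : a ≠ b) (hnab : ¬ G.Adj a b) (haX : ∃ t ∈ X, G.Adj a t)
    (hbX : ∃ t ∈ X, G.Adj b t) :
    ∃ S ⊆ X, InducedPath G a b (insert a (insert b S)) ∧ G.ConnectedOn S ∧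
      (∃ t ∈ S, G.Adj a t) ∧ ∃ t ∈ S, G.Adj b t := by
  obtain ⟨s, hs, has⟩ := haX
  obtain ⟨t, ht, hbt⟩ := hbX
  obtain ⟨S, hSX, hS⟩ := hX s hs t ht
  obtain ⟨p, S₁, S₂, -, hS₂, rfl, -, hap, hp⟩ := hS.exists_last (G.Adj a) ⟨s, hS.left_mem, has⟩
  obtain ⟨q, S₃, S₄, hS₃, -, rfl, -, hbq, hq⟩ := hS₂.exists_first (G.Adj b) ⟨t, hS₂.right_mem, hbt⟩
  have hX3 : S₃ ⊆ X := fun x hx => hSX (Or.inr (Or.inl hx))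
  have h1 : InducedPath G b p (insert b S₃) :=
    .cons hbq hS₃.reverse (fun h => hb (hX3 h)) hq
  refine ⟨S₃, hX3, .cons hap h1.reverse ?_ ?_, hS₃.connectedOn, ⟨p, hS₃.left_mem, hap⟩,
    ⟨q, hS₃.right_mem, hbq⟩⟩
  · rintro (h | h)
    exacts [hab h, ha (hX3 h)]
  · rintro x (rfl | hx) hax
    exacts [absurd hax hnab, hp x (Or.inl hx) hax]

variable {v : Fin 3 → V} {X Y : Set V}

theorem IsAttached.exists_minimal [Finite V] (hX : G.IsAttached v X) :
    ∃ X₀ ⊆ X, G.IsAttached v X₀ ∧ ∀ X' ⊆ X₀, G.IsAttached v X' → X' = X₀ := by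
  obtain ⟨M, ⟨hMX, hM⟩, hmin⟩ := Set.Finite.exists_minimalFor (fun M : Set V => M)
    {M | M ⊆ X ∧ G.IsAttached v M} (Set.toFinite _) ⟨X, subset_rfl, hX⟩
  exact ⟨M, hMX, hM, fun X' h1 h2 => h1.antisymm (hmin ⟨h1.trans hMX, h2⟩ h1)⟩

/-- In a minimal attached set, a terminal with two neighbours sees two vertices of a path joining
the other two terminals: otherwise a vertex off the path could be removed. -/
theorem IsAttached.seesTwo_of_minimal [Finite V] (hX : G.IsAttached v X)
    (hv : ∀ i j, i ≠ j → v i ≠ v j ∧ ¬ G.Adj (v i) (v j))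
    (hmin : ∀ X' ⊆ X, G.IsAttached v X' → X' = X) {k : Fin 3} {s t : V} (hs : s ∈ X) (ht : t ∈ X)
    (hst : s ≠ t) (hks : G.Adj (v k) s) (hkt : G.Adj (v k) t) : G.SeesTwo v X k := by
  obtain ⟨i, hik, -⟩ := exists_fin3_ne k k
  obtain ⟨j, hji, hjk⟩ := exists_fin3_ne i k
  obtain ⟨S, hSX, hS, hSc, hiS, hjS⟩ := hX.connectedOn.exists_inducedPath_through (hX.notMem i)
    (hX.notMem j) (hv i j hji.symm).1 (hv i j hji.symm).2 (hX.exists_adj i) (hX.exists_adj j)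
  by_cases hSX' : S = X
  · subst hSX'
    refine ⟨i, j, _, hji.symm, hik.symm, hjk.symm, hS, ?_, s, Or.inr (Or.inr hs), t,
      Or.inr (Or.inr ht), hst, hks, hkt⟩
    rintro w (rfl | rfl | hw)
    exacts [Or.inr (Or.inl rfl), Or.inr (Or.inr rfl), Or.inl hw]
  · exfalso
    obtain ⟨x, hx, hix⟩ := hiS
    obtain ⟨y, hy, hjy⟩ := hjS
    obtain ⟨u, huX, huS, hu⟩ := hX.connectedOn.exists_diff_singleton hSc hx
      (hSX.ssubset_of_ne hSX')
    have hne : ∀ w ∈ S, w ∈ X \ {u} := fun w hw => ⟨hSX hw, by rintro rfl; exact huS hw⟩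
    have := hmin (X \ {u}) Set.sdiff_subset ⟨hu, fun i h => hX.notMem i h.1, fun m => ?_⟩
    · rw [← this] at huX
      exact huX.2 rfl
    · rcases fin3_cases hik.symm hjk hji m with rfl | rfl | rfl
      · by_cases hsu : s = u
        · exact ⟨t, ⟨ht, fun h => hst (hsu.trans (Eq.symm h))⟩, hkt⟩
        · exact ⟨s, ⟨hs, hsu⟩, hks⟩
      · exact ⟨x, hne x hx, hix⟩
      · exact ⟨y, hne y hy, hjy⟩

/-- A minimal attached set contains a spider or a net through which it is attached, except that
a terminal which sees two vertices may serve as the center or as a corner. -/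
theorem IsAttached.exists_spider_or_net [Finite V] (hX : G.IsAttached v X)
    (hv : ∀ i j, i ≠ j → v i ≠ v j ∧ ¬ G.Adj (v i) (v j))
    (hmin : ∀ X' ⊆ X, G.IsAttached v X' → X' = X) :
    (∃ c L, G.IsSpider v c L ∧ (∀ i, L i ⊆ insert (v i) (insert c X)) ∧
      (c ∈ X ∨ ∃ k, c = v k ∧ G.SeesTwo v X k)) ∨
    ∃ b L, G.IsNet v b L ∧ (∀ i, L i ⊆ insert (v i) X) ∧
      ∀ k, b k ∈ X ∨ b k = v k ∧ G.SeesTwo v X k := by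
  have hnv : ∀ i j, ¬ G.Adj (v i) (v j) := by
    intro i j h
    by_cases hij : i = j
    · exact h.ne (by rw [hij])
    · exact (hv i j hij).2 h
  have hW : G.ConnectedOn (X ∪ Set.range v) := by
    obtain ⟨r, hr, -⟩ := hX.exists_adj 0
    refine .of_root r ?_
    have hXr : ∀ w ∈ X, G.Joined (X ∪ Set.range v) w r := fun w hw =>
      (hX.connectedOn w hw r hr).mono Set.subset_union_left
    rintro w (hw | ⟨i, rfl⟩)
    · exact hXr w hw
    · obtain ⟨t, ht, hit⟩ := hX.exists_adj i
      exact (hXr t ht).head hit (Or.inr ⟨i, rfl⟩)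
  have hWX : ∀ k, ∀ w ∈ X ∪ Set.range v, G.Adj (v k) w → w ∈ X := by
    rintro k w (hw | ⟨i, rfl⟩) hkw
    exacts [hw, absurd hkw (hnv k i)]
  rcases hW.exists_spider_or_net fun i => Or.inr ⟨i, rfl⟩ with
    ⟨c, L, ⟨hL, hc⟩, hLW⟩ | ⟨b, L, ⟨hL, hb, hc⟩, hLW⟩
  · refine Or.inl ⟨c, L, ⟨hL, hc⟩, ?_, ?_⟩
    · intro i w hw
      rcases hLW i hw with h | ⟨m, rfl⟩
      · exact Or.inr (Or.inr h)
      · by_cases him : i = m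
        · exact Or.inl (by rw [him])
        · rcases hc i m him _ hw _ (hL m).right_mem (Or.inl rfl) with h | h <;>
            exact Or.inr (Or.inl h)
    · rcases hLW 0 (hL 0).left_mem with h | ⟨k, hk⟩
      · exact Or.inl h
      subst hk
      refine Or.inr ⟨k, rfl, ?_⟩
      obtain ⟨i, hik, -⟩ := exists_fin3_ne k k
      obtain ⟨j, hji, hjk⟩ := exists_fin3_ne i k
      obtain ⟨s, hs, hks⟩ := (hL i).exists_adj_left (hv k i hik.symm).1
      obtain ⟨t, ht, hkt⟩ := (hL j).exists_adj_left (hv k j hjk.symm).1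
      refine hX.seesTwo_of_minimal hv hmin (hWX k s (hLW i hs) hks) (hWX k t (hLW j ht) hkt) ?_
        hks hkt
      intro hst
      rcases hc i j hji.symm s hs t ht (Or.inl hst) with h | h
      exacts [hks.ne h.symm, hkt.ne h.symm]
  · have hbv : ∀ i m, v m ∈ L i → i = m := by
      intro i m hw
      by_contra him
      obtain ⟨h1, h2⟩ := hc i m him _ hw _ (hL m).right_mem (Or.inl rfl)
      exact (hb i m him).ne (h1.symm.trans h2)
    refine Or.inr ⟨b, L, ⟨hL, hb, hc⟩, ?_, ?_⟩
    · intro i w hw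
      rcases hLW i hw with h | ⟨m, rfl⟩
      · exact Or.inr h
      · exact Or.inl (by rw [hbv i m hw])
    · intro k
      rcases hLW k (hL k).left_mem with h | ⟨m, hm⟩
      · exact Or.inl h
      obtain rfl := hbv k m (hm ▸ (hL k).left_mem)
      refine Or.inr ⟨hm.symm, ?_⟩
      obtain ⟨i, hik, -⟩ := exists_fin3_ne k k
      obtain ⟨j, hji, hjk⟩ := exists_fin3_ne i k
      have hki : G.Adj (v k) (b i) := hm ▸ hb k i hik.symm
      have hkj : G.Adj (v k) (b j) := hm ▸ hb k j hjk.symm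
      exact hX.seesTwo_of_minimal hv hmin (hWX k _ (hLW i (hL i).left_mem) hki)
        (hWX k _ (hLW j (hL j).left_mem) hkj) (hb i j hji.symm).ne hki hkj

/-! ### Gluing the two sides -/

/-- A terminal that sees two vertices on one side and one vertex on the other is the center of a
broken wheel, whose long sectors run through the other two terminals. -/
theorem SeesTwo.isBrokenWheel (hv : ∀ i j, i ≠ j → v i ≠ v j ∧ ¬ G.Adj (v i) (v j))
    (hXY : G.Anticomplete X Y) (hX : ∀ i, v i ∉ X) (hY : ∀ i, v i ∉ Y) {k : Fin 3}
    (h2 : G.SeesTwo v X k) (h1 : G.SeesOne v Y k) : ∃ D : Set V, (G.induce D).IsBrokenWheel := by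
  obtain ⟨i, j, S, hij, hki, hkj, hS, hSX, x₁, hx₁, x₂, hx₂, hx₁₂, hkx₁, hkx₂⟩ := h2
  obtain ⟨T, hT, hTY, x₃, hx₃, hkx₃⟩ : ∃ T, InducedPath G (v i) (v j) T ∧ T ⊆ Y ∪ {v i, v j} ∧
      ∃ p ∈ T, G.Adj (v k) p := by
    obtain ⟨i', j', T, hij', hki', hkj', hT, hTY, hp⟩ := h1
    have : i' = i ∧ j' = j ∨ i' = j ∧ j' = i := by
      have := fin3_cases hij hki hkj i'
      have := fin3_cases hij hki hkj j'
      grind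
    rcases this with ⟨rfl, rfl⟩ | ⟨rfl, rfl⟩
    · exact ⟨T, hT, hTY, hp⟩
    · exact ⟨T, hT.reverse, by rwa [Set.pair_comm], hp⟩
  have hkvi := (hv k i hki).2
  have hkvj := (hv k j hkj).2
  have hSX' : ∀ x ∈ S, x ≠ v i → x ≠ v j → x ∈ X := by
    intro x hx hxi hxj
    rcases hSX hx with h | h | h
    exacts [h, absurd h hxi, absurd h hxj]
  have hTY' : ∀ x ∈ T, x ≠ v i → x ≠ v j → x ∈ Y := by
    intro x hx hxi hxj
    rcases hTY hx with h | h | h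
    exacts [h, absurd h hxi, absurd h hxj]
  have hcross : ∀ s ∈ S, ∀ t ∈ T, s = t ∨ G.Adj s t →
      s = v i ∨ s = v j ∨ t = v i ∨ t = v j := by
    intro s hs t ht hst
    by_contra! hcon
    have := hXY s (hSX' s hs hcon.1 hcon.2.1) t (hTY' t ht hcon.2.2.1 hcon.2.2.2)
    tauto
  have hnbr : ∀ w, G.Adj (v k) w → w ≠ v i ∧ w ≠ v j := by
    intro w hw
    exact ⟨fun h => hkvi (h ▸ hw), fun h => hkvj (h ▸ hw)⟩
  have hnS : ∀ w ∈ S, G.Adj (v k) w → w ∈ X := fun w hw h =>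
    hSX' w hw (hnbr w h).1 (hnbr w h).2
  have hnT : ∀ w ∈ T, G.Adj (v k) w → w ∈ Y := fun w hw h =>
    hTY' w hw (hnbr w h).1 (hnbr w h).2
  obtain ⟨p, q, S₁, S₀, S₂, hS₁, hS₀, hS₂, hSe, hp, hq, hp₁, hq₂, hc₁, hc₂⟩ :=
    hS.exists_first_last (G.Adj (v k)) ⟨x₁, hx₁, hkx₁⟩
  obtain ⟨p', q', T₁, T₀, T₂, hT₁, hT₀, hT₂, hTe, hp', hq', hp₁', hq₂', hc₁', hc₂'⟩ :=
    hT.exists_first_last (G.Adj (v k)) ⟨x₃, hx₃, hkx₃⟩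
  have hS₁S : S₁ ⊆ S := fun w hw => hSe ▸ Or.inl (Or.inl hw)
  have hS₂S : S₂ ⊆ S := fun w hw => hSe ▸ Or.inr hw
  have hT₁T : T₁ ⊆ T := fun w hw => hTe ▸ Or.inl (Or.inl hw)
  have hT₂T : T₂ ⊆ T := fun w hw => hTe ▸ Or.inr hw
  have hjS₁ : v j ∉ S₁ := fun h => by
    have := hc₁ _ h _ (Or.inr hS₂.right_mem) (Or.inl rfl)
    exact (hnbr p hp).2 (by tauto)
  have hiS₂ : v i ∉ S₂ := fun h => by
    have := hc₂ _ (Or.inl hS₁.left_mem) _ h (Or.inl rfl)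
    exact (hnbr q hq).1 (by tauto)
  have hjT₁ : v j ∉ T₁ := fun h => by
    have := hc₁' _ h _ (Or.inr hT₂.right_mem) (Or.inl rfl)
    exact (hnbr p' hp').2 (by tauto)
  have hiT₂ : v i ∉ T₂ := fun h => by
    have := hc₂' _ (Or.inl hT₁.left_mem) _ h (Or.inl rfl)
    exact (hnbr q' hq').1 (by tauto)
  have hA : G.IsLongSector (v k) p p' (S₁ ∪ T₁) := by
    have hpp' := hXY p (hnS p (hS₁S hS₁.right_mem) hp) p' (hnT p' (hT₁T hT₁.right_mem) hp')
    refine ⟨hS₁.reverse.append hT₁ ?_, hpp'.1, hpp'.2, hp, hp', ?_⟩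
    · intro s hs t ht hst
      rcases hcross s (hS₁S hs) t (hT₁T ht) hst with h | h | h | h
      exacts [Or.inl h, absurd (h ▸ hs) hjS₁, Or.inr h, absurd (h ▸ ht) hjT₁]
    · rintro w (hw | hw) hwp hwp' hkw
      exacts [hwp (hp₁ w hw hkw), hwp' (hp₁' w hw hkw)]
  have hB : G.IsLongSector (v k) q q' (S₂ ∪ T₂) := by
    have hqq' := hXY q (hnS q (hS₂S hS₂.left_mem) hq) q' (hnT q' (hT₂T hT₂.left_mem) hq')
    refine ⟨hS₂.append hT₂.reverse ?_, hqq'.1, hqq'.2, hq, hq', ?_⟩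
    · intro s hs t ht hst
      rcases hcross s (hS₂S hs) t (hT₂T ht) hst with h | h | h | h
      exacts [absurd (h ▸ hs) hiS₂, Or.inl h, absurd (h ▸ ht) hiT₂, Or.inr h]
    · rintro w (hw | hw) hwq hwq' hkw
      exacts [hwq (hq₂ w hw hkw), hwq' (hq₂' w hw hkw)]
  have hx₃Y := hnT x₃ hx₃ hkx₃
  refine ⟨_, isBrokenWheel_induce hS hT (hv i j hij).1 (hv i j hij).2 hcross ?_ (Or.inl hx₁)
    (Or.inl hx₂) (Or.inr hx₃) hkx₁ hkx₂ hkx₃ hx₁₂ (hXY x₁ (hnS x₁ hx₁ hkx₁) x₃ hx₃Y).1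
    (hXY x₂ (hnS x₂ hx₂ hkx₂) x₃ hx₃Y).1 hA hB (Set.union_subset_union hS₁S hT₁T)
    (Set.union_subset_union hS₂S hT₂T) ?_⟩
  · rintro (h | h)
    · exact hX k (hSX' _ h (hv k i hki).1 (hv k j hkj).1)
    · exact hY k (hTY' _ h (hv k i hki).1 (hv k j hkj).1)
  · intro hAB
    have : v i ∈ S₂ ∪ T₂ := hAB ▸ Or.inl hS₁.left_mem
    rcases this with h | h
    exacts [hiS₂ h, hiT₂ h]

theorem IsSpider.seesOne {c : V} {L : Fin 3 → Set V} (h : G.IsSpider v c L)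
    (hL : ∀ i, L i ⊆ insert (v i) (insert c X)) (hc : c ∈ X) {k : Fin 3} (hkc : G.Adj (v k) c) :
    G.SeesOne v X k := by
  obtain ⟨i, hik, -⟩ := exists_fin3_ne k k
  obtain ⟨j, hji, hjk⟩ := exists_fin3_ne i k
  refine ⟨i, j, L i ∪ L j, hji.symm, hik.symm, hjk.symm, (h.1 i).reverse.append (h.1 j)
    (h.2 i j hji.symm), ?_, c, Or.inl (h.1 i).left_mem, hkc⟩
  rintro w (hw | hw)
  · rcases hL i hw with rfl | rfl | h
    exacts [Or.inr (Or.inl rfl), Or.inl hc, Or.inl h]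
  · rcases hL j hw with rfl | rfl | h
    exacts [Or.inr (Or.inr rfl), Or.inl hc, Or.inl h]

/-- Two spiders on the same terminals with distinct nonadjacent centers form a theta. -/
theorem IsSpider.isTheta {c c' : V} {L L' : Fin 3 → Set V} (h : G.IsSpider v c L)
    (h' : G.IsSpider v c' L') (hXY : G.Anticomplete X Y)
    (hL : ∀ i, L i ⊆ insert (v i) (insert c X)) (hL' : ∀ i, L' i ⊆ insert (v i) (insert c' Y))
    (hc : c ∈ X ∨ ∃ k, c = v k) (hc' : c' ∈ Y ∨ ∃ k, c' = v k) (hne : c ≠ c')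
    (hadj : ¬ G.Adj c c') : (G.induce (⋃ i, (L i ∪ L' i))).IsTheta := by
  obtain ⟨hP, hcr⟩ := h
  obtain ⟨hP', hcr'⟩ := h'
  have hmix : ∀ i j, i ≠ j → ∀ s ∈ L i, ∀ t ∈ L' j, s = t ∨ G.Adj s t →
      s = c ∨ s = c' ∨ t = c ∨ t = c' := by
    intro i j hij s hs t ht hst
    rcases hL i hs with rfl | rfl | hsX
    · have := hcr' i j hij _ (hP' i).right_mem t ht hst
      tauto
    · exact Or.inl rfl
    rcases hL' j ht with rfl | rfl | htY
    · have := hcr i j hij s hs _ (hP j).right_mem hst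
      tauto
    · exact Or.inr (Or.inr (Or.inr rfl))
    · have := hXY s hsX t htY
      tauto
  refine isTheta_induce (a := c) (b := c') (fun i => (hP i).append (hP' i).reverse ?_) hne hadj ?_
  · intro s hs t ht hst
    by_cases hsv : s = v i
    · exact Or.inl hsv
    by_cases htv : t = v i
    · exact Or.inr htv
    exfalso
    have hnot : ¬ (s = c ∧ t = c') := by
      rintro ⟨rfl, rfl⟩
      exact hst.elim hne hadj
    -- Either `s` or `t` is a center that is a terminal `v k`, and lies on the leg `k` of the other
    -- side.
    rcases (hL i hs).resolve_left hsv with rfl | hsX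
    · have htY : t ∈ Y := ((hL' i ht).resolve_left htv).resolve_left fun h => hnot ⟨rfl, h⟩
      rcases hc with hsX | ⟨k, rfl⟩
      · have := hXY s hsX t htY
        tauto
      · have hki : k ≠ i := fun h => hsv (by rw [h])
        rcases hcr' k i hki _ (hP' k).right_mem t ht hst with h | h
        · exact hne h
        · exact hnot ⟨rfl, h⟩
    · rcases (hL' i ht).resolve_left htv with rfl | htY
      · rcases hc' with htY | ⟨k, rfl⟩
        · have := hXY s hsX t htY
          tauto
        · have hki : i ≠ k := fun h => htv (by rw [h])
          rcases hcr i k hki s hs _ (hP k).right_mem hst with h | h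
          · exact hnot ⟨h, rfl⟩
          · exact hne h.symm
      · have := hXY s hsX t htY
        tauto
  · rintro i j hij s (hs | hs) t (ht | ht) hst
    · have := hcr i j hij s hs t ht hst
      tauto
    · exact hmix i j hij s hs t ht hst
    · have := hmix j i hij.symm t ht s hs (hst.imp Eq.symm fun h => h.symm)
      tauto
    · have := hcr' i j hij s hs t ht hst
      tauto

theorem IsNet.exists_forall_ne {b : Fin 3 → V} {L : Fin 3 → Set V} (h : G.IsNet v b L)
    (hv : ∀ i j, i ≠ j → v i ≠ v j ∧ ¬ G.Adj (v i) (v j)) : ∃ k, ∀ i, i ≠ k → b i ≠ v i := by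
  by_cases hk : ∃ k, b k = v k
  · obtain ⟨k, hk⟩ := hk
    refine ⟨k, fun i hik hi => (hv i k hik).2 ?_⟩
    rw [← hi, ← hk]
    exact h.2.1 i k hik
  · exact ⟨0, fun i _ hi => hk ⟨i, hi⟩⟩

/-- A spider and a net on the same terminals form a pyramid when the center is not a corner. -/
theorem IsSpider.isPyramid {c : V} {b : Fin 3 → V} {L L' : Fin 3 → Set V} (h : G.IsSpider v c L)
    (h' : G.IsNet v b L') (hv : ∀ i j, i ≠ j → v i ≠ v j ∧ ¬ G.Adj (v i) (v j))
    (hXY : G.Anticomplete X Y) (hL : ∀ i, L i ⊆ insert (v i) (insert c X))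
    (hL' : ∀ i, L' i ⊆ insert (v i) Y) (hc : c ∈ X ∨ ∃ k, c = v k) (hne : ∀ i, c ≠ b i) :
    (G.induce (⋃ i, (L i ∪ L' i))).IsPyramid := by
  obtain ⟨k₀, hk₀⟩ := h'.exists_forall_ne hv
  obtain ⟨hP, hcr⟩ := h
  obtain ⟨hP', hb, hcr'⟩ := h'
  have hmix : ∀ i j, i ≠ j → ∀ s ∈ L i, ∀ t ∈ L' j, s = t ∨ G.Adj s t →
      (s = b i ∧ t = b j) ∨ s = c ∨ t = c := by
    intro i j hij s hs t ht hst
    rcases hL i hs with rfl | rfl | hsX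
    · exact Or.inl (hcr' i j hij _ (hP' i).right_mem t ht hst)
    · exact Or.inr (Or.inl rfl)
    rcases hL' j ht with rfl | htY
    · exact Or.inr (hcr i j hij s hs _ (hP j).right_mem hst)
    · have := hXY s hsX t htY
      tauto
  -- A terminal that serves as center sees nothing of the net on the other legs.
  have hsep : ∀ k i, c = v k → k ≠ i → ∀ t ∈ L' i, ¬ (c = t ∨ G.Adj c t) := by
    rintro k i rfl hki t ht hst
    exact hne k (hcr' k i hki _ (hP' k).right_mem t ht hst).1
  refine isPyramid_induce (a := c) (fun i => (hP i).append (hP' i).reverse ?_) hne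
    ?_ hb ?_
  · intro s hs t ht hst
    by_cases hsv : s = v i
    · exact Or.inl hsv
    rcases hL' i ht with htv | htY
    · exact Or.inr htv
    exfalso
    rcases (hL i hs).resolve_left hsv with rfl | hsX
    · rcases hc with hsX | ⟨k, hk⟩
      · have := hXY s hsX t htY
        tauto
      · exact hsep k i hk (fun h => hsv (by rw [hk, h])) t ht hst
    · have := hXY s hsX t htY
      tauto
  · rcases hc with hcX | ⟨k, hk⟩
    · refine ⟨k₀, fun i hi => (hXY c hcX (b i) ?_).2⟩
      exact (hL' i (hP' i).left_mem).resolve_left (hk₀ i hi)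
    · exact ⟨k, fun i hi h => hsep k i hk hi.symm _ (hP' i).left_mem (Or.inr h)⟩
  · rintro i j hij s (hs | hs) t (ht | ht) hst
    · exact Or.inr (hcr i j hij s hs t ht hst)
    · exact hmix i j hij s hs t ht hst
    · have := hmix j i hij.symm t ht s hs (hst.imp Eq.symm fun h => h.symm)
      tauto
    · exact Or.inl (hcr' i j hij s hs t ht hst)

/-- Two nets on the same terminals without a common corner form a long prism. -/
theorem IsNet.isLongPrism {b b' : Fin 3 → V} {L L' : Fin 3 → Set V} (h : G.IsNet v b L)
    (h' : G.IsNet v b' L') (hv : ∀ i j, i ≠ j → v i ≠ v j ∧ ¬ G.Adj (v i) (v j))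
    (hXY : G.Anticomplete X Y) (hL : ∀ i, L i ⊆ insert (v i) X)
    (hL' : ∀ i, L' i ⊆ insert (v i) Y) (hne : ∀ i, b i ≠ b' i) :
    (G.induce (⋃ i, (L i ∪ L' i))).IsLongPrism := by
  obtain ⟨k, hk⟩ := h.exists_forall_ne hv
  obtain ⟨k', hk'⟩ := h'.exists_forall_ne hv
  obtain ⟨hP, hb, hcr⟩ := h
  obtain ⟨hP', hb', hcr'⟩ := h'
  have hmix : ∀ i j, i ≠ j → ∀ s ∈ L i, ∀ t ∈ L' j, s = t ∨ G.Adj s t →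
      (s = b i ∧ t = b j) ∨ (s = b' i ∧ t = b' j) := by
    intro i j hij s hs t ht hst
    rcases hL i hs with rfl | hsX
    · exact Or.inr (hcr' i j hij _ (hP' i).right_mem t ht hst)
    rcases hL' j ht with rfl | htY
    · exact Or.inl (hcr i j hij s hs _ (hP j).right_mem hst)
    · have := hXY s hsX t htY
      tauto
  refine isLongPrism_induce (fun i => (hP i).append (hP' i).reverse ?_) hne ?_ hb hb' ?_
  · intro s hs t ht hst
    rcases hL i hs with hsv | hsX
    · exact Or.inl hsv
    rcases hL' i ht with htv | htY
    · exact Or.inr htv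
    · have := hXY s hsX t htY
      tauto
  · obtain ⟨i, hik, hik'⟩ := exists_fin3_ne k k'
    exact ⟨i, (hXY _ ((hL i (hP i).left_mem).resolve_left (hk i hik)) _
      ((hL' i (hP' i).left_mem).resolve_left (hk' i hik'))).2⟩
  · rintro i j hij s (hs | hs) t (ht | ht) hst
    · exact Or.inl (hcr i j hij s hs t ht hst)
    · exact hmix i j hij s hs t ht hst
    · have := hmix j i hij.symm t ht s hs (hst.imp Eq.symm fun h => h.symm)
      tauto
    · exact Or.inr (hcr' i j hij s hs t ht hst)

/-- Three pairwise nonadjacent terminals attached to two anticomplete connected sets yield one of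
the four configurations. -/
theorem IsAttached.exists_configuration [Finite V] (hX : G.IsAttached v X) (hY : G.IsAttached v Y)
    (hv : ∀ i j, i ≠ j → v i ≠ v j ∧ ¬ G.Adj (v i) (v j)) (hXY : G.Anticomplete X Y) :
    (∃ S : Set V, (G.induce S).IsLongPrism) ∨ (∃ S : Set V, (G.induce S).IsPyramid) ∨
      (∃ S : Set V, (G.induce S).IsTheta) ∨ ∃ S : Set V, (G.induce S).IsBrokenWheel := by
  by_contra! hcon
  obtain ⟨hprism, hpyr, htheta, hwheel⟩ := hcon
  obtain ⟨X₀, hX₀, hX, hXmin⟩ := hX.exists_minimal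
  obtain ⟨Y₀, hY₀, hY, hYmin⟩ := hY.exists_minimal
  replace hXY : G.Anticomplete X₀ Y₀ := fun s hs t ht => hXY s (hX₀ hs) t (hY₀ ht)
  have hv_inj : ∀ i j, v i = v j → i = j := fun i j h => by
    by_contra hij
    exact (hv i j hij).1 h
  have hnv : ∀ i j, ¬ G.Adj (v i) (v j) := by
    intro i j h
    by_cases hij : i = j
    · exact h.ne (by rw [hij])
    · exact (hv i j hij).2 h
  have hXw : ∀ k, G.SeesTwo v X₀ k → ¬ G.SeesOne v Y₀ k := fun k h2 h1 =>
    let ⟨D, hD⟩ := h2.isBrokenWheel hv hXY hX.notMem hY.notMem h1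
    hwheel D hD
  have hYw : ∀ k, G.SeesTwo v Y₀ k → ¬ G.SeesOne v X₀ k := fun k h2 h1 =>
    let ⟨D, hD⟩ := h2.isBrokenWheel hv hXY.symm hY.notMem hX.notMem h1
    hwheel D hD
  rcases hX.exists_spider_or_net hv hXmin with ⟨c, L, hs, hL, hc⟩ | ⟨b, L, hn, hL, hb⟩ <;>
    rcases hY.exists_spider_or_net hv hYmin with ⟨c', L', hs', hL', hc'⟩ | ⟨b', L', hn', hL', hb'⟩
  · have key : c ≠ c' ∧ ¬ G.Adj c c' := by
      rcases hc with hc | ⟨k, rfl, hk⟩ <;> rcases hc' with hc' | ⟨l, rfl, hl⟩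
      · exact hXY c hc c' hc'
      · exact ⟨fun h => hX.notMem l (h ▸ hc), fun h => hYw l hl (hs.seesOne hL hc h.symm)⟩
      · exact ⟨fun h => hY.notMem k (h ▸ hc'), fun h => hXw k hk (hs'.seesOne hL' hc' h)⟩
      · refine ⟨fun h => ?_, hnv k l⟩
        obtain rfl := hv_inj k l h
        exact hXw k hk hl.seesOne
    exact htheta _ (hs.isTheta hs' hXY hL hL' (hc.imp_right fun ⟨k, h, _⟩ => ⟨k, h⟩)
      (hc'.imp_right fun ⟨k, h, _⟩ => ⟨k, h⟩) key.1 key.2)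
  · refine hpyr _ (hs.isPyramid hn' hv hXY hL hL' (hc.imp_right fun ⟨k, h, _⟩ => ⟨k, h⟩) ?_)
    intro i h
    rcases hc with hc | ⟨k, rfl, hk⟩ <;> rcases hb' i with hb | ⟨hb, hi⟩
    · exact (hXY c hc _ hb).1 h
    · exact hX.notMem i (hb ▸ h ▸ hc)
    · exact hY.notMem k (h ▸ hb)
    · obtain rfl := hv_inj k i (h.trans hb)
      exact hXw k hk hi.seesOne
  · refine hpyr _ (hs'.isPyramid hn hv hXY.symm hL' hL
      (hc'.imp_right fun ⟨k, h, _⟩ => ⟨k, h⟩) ?_)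
    intro i h
    rcases hc' with hc | ⟨k, rfl, hk⟩ <;> rcases hb i with hb | ⟨hb, hi⟩
    · exact (hXY _ hb c' hc).1 h.symm
    · exact hY.notMem i (hb ▸ h ▸ hc)
    · exact hX.notMem k (h ▸ hb)
    · obtain rfl := hv_inj k i (h.trans hb)
      exact hYw k hk hi.seesOne
  · refine hprism _ (hn.isLongPrism hn' hv hXY hL hL' ?_)
    intro i h
    rcases hb i with hb | ⟨hb, hi⟩ <;> rcases hb' i with hb' | ⟨hb', hi'⟩
    · exact (hXY _ hb _ hb').1 h
    · exact hX.notMem i (hb' ▸ h ▸ hb)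
    · exact hY.notMem i (hb ▸ h ▸ hb')
    · exact hXw i hi hi'.seesOne

/-- In a model of `K_{2,3}`, each branch set of the side of size three can be cut down to a single
terminal by moving the rest of a path through it to the branch set `Y`. -/
theorem IsModel.exists_isAttached {B : Fin 2 ⊕ Fin 3 → Set V}
    (h : IsModel (completeBipartiteGraph (Fin 2) (Fin 3)) G B) :
    ∃ (v : Fin 3 → V) (X Y : Set V), G.IsAttached v X ∧ G.IsAttached v Y ∧
      (∀ i j, i ≠ j → v i ≠ v j ∧ ¬ G.Adj (v i) (v j)) ∧ G.Anticomplete X Y := by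
  obtain ⟨hne, hconn, hdisj, hadj⟩ := h
  set X := B (Sum.inl 0) with hX
  set Y := B (Sum.inl 1) with hY
  have hXA : ∀ i, ∃ s ∈ X, ∃ t ∈ B (Sum.inr i), G.Adj s t := fun i =>
    (hadj _ _ (by simp)).1 (by simp)
  have hYA : ∀ i, ∃ s ∈ Y, ∃ t ∈ B (Sum.inr i), G.Adj s t := fun i =>
    (hadj _ _ (by simp)).1 (by simp)
  have hanti : ∀ u u', u ≠ u' → ¬ (completeBipartiteGraph (Fin 2) (Fin 3)).Adj u u' →
      G.Anticomplete (B u) (B u') := by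
    intro u u' huu hn s hs t ht
    refine ⟨fun h => huu (hdisj u u' s hs (h ▸ ht)), fun h => hn ?_⟩
    exact (hadj u u' huu).2 ⟨s, hs, t, ht, h⟩
  have hpath : ∀ i, ∃ p q S, S ⊆ B (Sum.inr i) ∧ InducedPath G p q S ∧ (∃ s ∈ X, G.Adj p s) ∧
      (∃ t ∈ Y, G.Adj q t) ∧ ∀ w ∈ S, (∃ s ∈ X, G.Adj w s) → w = p := by
    intro i
    obtain ⟨s, hs, a, ha, hsa⟩ := hXA i
    obtain ⟨t, ht, b, hb, htb⟩ := hYA i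
    obtain ⟨S, hSB, hS⟩ := hconn _ a ha b hb
    obtain ⟨p, S₁, S₂, -, hS₂, rfl, -, hp, hp'⟩ :=
      hS.exists_last (fun w => ∃ s ∈ X, G.Adj w s) ⟨a, hS.left_mem, s, hs, hsa.symm⟩
    exact ⟨p, b, S₂, Set.subset_union_right.trans hSB, hS₂, hp, ⟨t, ht, htb.symm⟩, hp'⟩
  choose p q S hSB hS hpX hqY hSp using hpath
  have hpB : ∀ i, p i ∈ B (Sum.inr i) := fun i => hSB i (hS i).left_mem
  refine ⟨p, X, Y ∪ ⋃ i, (S i \ {p i}), ⟨hconn _, ?_, hpX⟩, ⟨?_, ?_, ?_⟩, ?_, ?_⟩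
  · intro i h
    exact Sum.inl_ne_inr (hdisj _ _ _ h (hpB i))
  · obtain ⟨r, hr⟩ := hne (Sum.inl 1)
    refine .of_root r ?_
    have hYr : ∀ w ∈ Y, G.Joined (Y ∪ ⋃ i, (S i \ {p i})) w r := fun w hw =>
      (hconn _ w hw r hr).mono Set.subset_union_left
    rintro w (hw | hw)
    · exact hYr w hw
    · obtain ⟨i, hwS, hwp⟩ := Set.mem_iUnion.1 hw
      have hpq : p i ≠ q i := by
        intro hpq
        have := hS i
        rw [← hpq] at this
        rw [this.eq_singleton] at hwS
        exact hwp hwS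
      obtain ⟨c, -, hc, -⟩ := (hS i).tail hpq
      obtain ⟨t, ht, hqt⟩ := hqY i
      have hsub : S i \ {p i} ⊆ Y ∪ ⋃ i, (S i \ {p i}) := fun w hw =>
        Or.inr (Set.mem_iUnion.2 ⟨i, hw⟩)
      exact ((hc.connectedOn w ⟨hwS, hwp⟩ _ hc.right_mem).mono hsub).trans
        ((hYr t ht).head hqt (hsub hc.right_mem))
  · rintro i (h | h)
    · exact Sum.inl_ne_inr (hdisj _ _ _ h (hpB i))
    · obtain ⟨j, hj, hpj⟩ := Set.mem_iUnion.1 h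
      obtain rfl := Sum.inr_injective (hdisj _ _ _ (hpB i) (hSB j hj))
      exact hpj rfl
  · intro i
    by_cases hpq : p i = q i
    · obtain ⟨t, ht, hqt⟩ := hqY i
      exact ⟨t, Or.inl ht, hpq ▸ hqt⟩
    · obtain ⟨c, hpc, hc, -⟩ := (hS i).tail hpq
      exact ⟨c, Or.inr (Set.mem_iUnion.2 ⟨i, hc.left_mem⟩), hpc⟩
  · intro i j hij
    exact hanti _ _ (fun h => hij (Sum.inr_injective h)) (by simp) _ (hpB i) _ (hpB j)
  · rintro s hs t (ht | ht)
    · exact hanti _ _ (by simp) (by simp) s hs t ht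
    · obtain ⟨i, hti, htp⟩ := Set.mem_iUnion.1 ht
      refine ⟨fun h => Sum.inl_ne_inr (hdisj _ _ s hs (h ▸ hSB i hti)), fun h => ?_⟩
      exact htp (hSp i t hti ⟨s, hs, h.symm⟩)

end SimpleGraph

theorem theoremt {V : Type*} [Finite V] (G : SimpleGraph V) :
    SimpleGraph.IsInducedMinor (completeBipartiteGraph (Fin 2) (Fin 3)) G ↔
      (∃ S : Set V, (G.induce S).IsLongPrism) ∨
      (∃ S : Set V, (G.induce S).IsPyramid) ∨
      (∃ S : Set V, (G.induce S).IsTheta) ∨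
      (∃ S : Set V, (G.induce S).IsBrokenWheel) := by
  constructor
  · intro h
    obtain ⟨B, hB⟩ := h.exists_isModel
    obtain ⟨v, X, Y, hX, hY, hv, hXY⟩ := hB.exists_isAttached
    exact hX.exists_configuration hY hv hXY
  · rintro (⟨S, hS⟩ | ⟨S, hS⟩ | ⟨S, hS⟩ | ⟨S, hS⟩) <;>
      obtain ⟨B, hB⟩ := hS.exists_isModel <;>
      exact hB.of_induce.isInducedMinor
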